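/- **Theorem.** Let $d\ge 2$ and let $\Omega\subset\mathbf R^d$ be a bounded Lipschitz domain. Let $$\mathcal H(\Omega)=\{\Phi\in L^2(\Omega)^{d\times d}:\ \operatorname{div}\Phi=0\text{ in }\Omega\},\qquad \mathcal W(\Omega)=\{\Phi\in W^{1,2}(\Omega)^{d\times d}:\ \operatorname{div}\Phi=0\text{ in }\Omega\},$$ where $(\operatorname{div}\Phi)_j=\sum_{i=1}^d\partial_i\Phi_{ij}$ in the sense of distributions, let $(\cdot,\cdot)$ denote the $L^2(\Omega)$ scalar product (of matrix fields, or of their gradients), and equip $\mathcal H(\Omega)$ with $(\Phi,\Xi)$ and $\mathcal W(\Omega)$ with the scalar product $(\nabla\Phi,\nabla\Xi)+(\Phi,\Xi)$. Then there are a sequence of real numbers $\{\lambda^j\}_{j=1}^\infty$ with $$1=\lambda^1=\dots=\lambda^{d^2}\le\lambda^{d^2+1}\le\dots\le\lambda^j\le\lambda^{j+1}\le\dots,\qquad \lambda^j\to\infty\text{ as }j\to\infty,$$ and a sequence $\{\Phi^j\}_{j=1}^\infty$ of nonzero elements of $\mathcal W(\Omega)$ such that, for every $j$, $$(\nabla\Phi^j,\nabla\Xi)+(\Phi^j,\Xi)=\lambda^j(\Phi^j,\Xi)\qquad\text{for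 all }\Xi\in\mathcal W(\Omega),$$ that is, the $\lambda^j$ are eigenvalues of this problem with eigenfunctions $\Phi^j$. Moreover, $\{\Phi^j\}_{j=1}^\infty$ is an orthonormal basis of $\mathcal H(\Omega)$ and an orthogonal basis of $\mathcal W(\Omega)$. -/

import Mathlib

open MeasureTheory Filter Topology
open scoped ContDiff

namespace DivFree

/-- Euclidean space `ℝ^d`. -/
abbrev Pt (d : ℕ) : Type := EuclideanSpace ℝ (Fin d)

/-- Real `d × d` matrices with the Frobenius scalar product; the entry `A_{ij}` is `A (i, j)`. -/
abbrev Mat (d : ℕ) : Type := EuclideanSpace ℝ (Fin d × Fin d)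

/-- Gradients of matrix fields, with the Euclidean scalar product; the entry `(k, i, j)` of the
gradient of `Φ` is `∂_k Φ_{ij}`. -/
abbrev Ten (d : ℕ) : Type := EuclideanSpace ℝ (Fin d × Fin d × Fin d)

/-- A bounded Lipschitz domain: a bounded, connected, nonempty open set which, near each of its
boundary points, is the set of points lying strictly on one side of the graph of a Lipschitz
function, in a suitable orthonormal coordinate system. Here `e` is the direction of the last
coordinate axis, `inner ℝ e y` the last coordinate of `y`, and `y - inner ℝ e y • e` the
projection of `y` to the hyperplane of the remaining coordinates. -/
structure IsBoundedLipschitzDomain {d : ℕ} (Ω : Set (Pt d)) : Prop where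
  isOpen : IsOpen Ω
  isConnected : IsConnected Ω
  isBounded : Bornology.IsBounded Ω
  lipschitz_boundary : ∀ x ∈ frontier Ω, ∃ (e : Pt d) (γ : Pt d → ℝ) (K : NNReal) (r : ℝ),
    ‖e‖ = 1 ∧ LipschitzWith K γ ∧ 0 < r ∧
      ∀ y ∈ Metric.ball x r, y ∈ Ω ↔ γ (y - inner ℝ e y • e) < inner ℝ e y

/-- Test functions: smooth functions on `ℝ^d` with compact support contained in `Ω`. -/
structure IsTest {d : ℕ} {F : Type*} [NormedAddCommGroup F] [NormedSpace ℝ F]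
    (Ω : Set (Pt d)) (φ : Pt d → F) : Prop where
  contDiff : ContDiff ℝ ∞ φ
  hasCompactSupport : HasCompactSupport φ
  tsupport_subset : tsupport φ ⊆ Ω

/-- The partial derivative `∂_i φ`. -/
noncomputable def pderiv {d : ℕ} {F : Type*} [NormedAddCommGroup F] [NormedSpace ℝ F]
    (i : Fin d) (φ : Pt d → F) (x : Pt d) : F :=
  fderiv ℝ φ x (EuclideanSpace.single i 1)

/-- The Hilbert space `L²(Ω)^{d×d}`. -/
abbrev L2Mat {d : ℕ} (Ω : Set (Pt d)) : Type := Lp (Mat d) 2 (volume.restrict Ω)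

/-- The Hilbert space `L²(Ω)^{d×d×d}`, in which gradients of matrix fields live. -/
abbrev L2Ten {d : ℕ} (Ω : Set (Pt d)) : Type := Lp (Ten d) 2 (volume.restrict Ω)

/-- `div Φ = 0` in `Ω` in the sense of distributions, where `(div Φ)_j = ∑ i, ∂_i Φ_{ij}`. -/
def IsDivFree {d : ℕ} {Ω : Set (Pt d)} (Φ : L2Mat Ω) : Prop :=
  ∀ φ : Pt d → Pt d, IsTest Ω φ →
    ∫ x in Ω, ∑ i, ∑ j, Φ x (i, j) * pderiv i φ x j = 0

/-- `G` is the weak (distributional) gradient of `Φ` in `Ω`. -/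
def HasWeakGradient {d : ℕ} {Ω : Set (Pt d)} (Φ : L2Mat Ω) (G : L2Ten Ω) : Prop :=
  ∀ φ : Pt d → ℝ, IsTest Ω φ → ∀ k i j,
    ∫ x in Ω, Φ x (i, j) * pderiv k φ x = -∫ x in Ω, G x (k, i, j) * φ x

section helpers

variable {d : ℕ} {Ω : Set (Pt d)}

theorem integrable_coord_mul {ι : Type*} [Fintype ι]
    (f : Lp (EuclideanSpace ℝ ι) 2 (volume.restrict Ω)) (a : ι)
    {g : Pt d → ℝ} (hg : Continuous g) (hc : HasCompactSupport g) :
    Integrable (fun x => f x a * g x) (volume.restrict Ω) :=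
  MemLp.integrable_mul (p := 2) (q := 2) ((Lp.memLp f).eval_piLp a)
    (hg.memLp_of_hasCompactSupport hc)

theorem IsTest.continuous_pderiv {F : Type*} [NormedAddCommGroup F] [NormedSpace ℝ F]
    {φ : Pt d → F} (h : IsTest Ω φ) (i : Fin d) : Continuous (pderiv i φ) :=
  (h.contDiff.continuous_fderiv (by simp)).clm_apply continuous_const

theorem IsTest.hasCompactSupport_pderiv {F : Type*} [NormedAddCommGroup F] [NormedSpace ℝ F]
    {φ : Pt d → F} (h : IsTest Ω φ) (i : Fin d) : HasCompactSupport (pderiv i φ) :=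
  h.hasCompactSupport.fderiv_apply (𝕜 := ℝ) (EuclideanSpace.single i 1)

theorem integrable_div_integrand (Φ : L2Mat Ω) {φ : Pt d → Pt d} (h : IsTest Ω φ) :
    Integrable (fun x => ∑ i, ∑ j, Φ x (i, j) * pderiv i φ x j) (volume.restrict Ω) := by
  refine integrable_finsetSum _ fun i _ => integrable_finsetSum _ fun j _ => ?_
  refine integrable_coord_mul Φ (i, j) (g := fun x => pderiv i φ x j) ?_ ?_
  · have := h.continuous_pderiv i
    fun_prop
  · exact (h.hasCompactSupport_pderiv i).comp_left (g := fun v : Pt d => v j) rfl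

theorem isDivFree_zero : IsDivFree (0 : L2Mat Ω) := by
  intro φ _
  refine (integral_congr_ae (g := fun _ => (0 : ℝ)) ?_).trans (by simp)
  filter_upwards [Lp.coeFn_zero (Mat d) 2 (volume.restrict Ω)] with x hx
  simp only [hx, Pi.zero_apply, PiLp.zero_apply, zero_mul, Finset.sum_const_zero]

theorem IsDivFree.add {Φ Ψ : L2Mat Ω} (hΦ : IsDivFree Φ) (hΨ : IsDivFree Ψ) :
    IsDivFree (Φ + Ψ) := by
  intro φ h
  have key := integral_add (integrable_div_integrand Φ h) (integrable_div_integrand Ψ h)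
  rw [hΦ φ h, hΨ φ h, add_zero] at key
  rw [← key]
  refine integral_congr_ae ?_
  filter_upwards [Lp.coeFn_add Φ Ψ] with x hx
  simp only [hx, Pi.add_apply, PiLp.add_apply, add_mul, Finset.sum_add_distrib]

theorem IsDivFree.smul {Φ : L2Mat Ω} (c : ℝ) (hΦ : IsDivFree Φ) : IsDivFree (c • Φ) := by
  intro φ h
  have key := integral_const_mul (μ := volume.restrict Ω) c
    (fun x => ∑ i, ∑ j, Φ x (i, j) * pderiv i φ x j)
  rw [hΦ φ h, mul_zero] at key
  rw [← key]
  refine integral_congr_ae ?_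
  filter_upwards [Lp.coeFn_smul c Φ] with x hx
  simp only [hx, Pi.smul_apply, PiLp.smul_apply, smul_eq_mul, Finset.mul_sum, mul_assoc]

theorem hasWeakGradient_zero : HasWeakGradient (0 : L2Mat Ω) 0 := by
  intro φ _ k i j
  have h1 : ∫ x in Ω, (0 : L2Mat Ω) x (i, j) * pderiv k φ x = 0 := by
    refine (integral_congr_ae (g := fun _ => (0 : ℝ)) ?_).trans (by simp)
    filter_upwards [Lp.coeFn_zero (Mat d) 2 (volume.restrict Ω)] with x hx
    simp only [hx, Pi.zero_apply, PiLp.zero_apply, zero_mul]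
  have h2 : ∫ x in Ω, (0 : L2Ten Ω) x (k, i, j) * φ x = 0 := by
    refine (integral_congr_ae (g := fun _ => (0 : ℝ)) ?_).trans (by simp)
    filter_upwards [Lp.coeFn_zero (Ten d) 2 (volume.restrict Ω)] with x hx
    simp only [hx, Pi.zero_apply, PiLp.zero_apply, zero_mul]
  rw [h1, h2, neg_zero]

theorem integral_coord_add {ι : Type*} [Fintype ι]
    (f f' : Lp (EuclideanSpace ℝ ι) 2 (volume.restrict Ω)) (a : ι)
    {g : Pt d → ℝ} (hg : Continuous g) (hc : HasCompactSupport g) :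
    ∫ x in Ω, (f + f') x a * g x = (∫ x in Ω, f x a * g x) + ∫ x in Ω, f' x a * g x := by
  rw [← integral_add (integrable_coord_mul f a hg hc) (integrable_coord_mul f' a hg hc)]
  refine integral_congr_ae ?_
  filter_upwards [Lp.coeFn_add f f'] with x hx
  simp only [hx, Pi.add_apply, PiLp.add_apply, add_mul]

theorem integral_coord_smul {ι : Type*} [Fintype ι] (c : ℝ)
    (f : Lp (EuclideanSpace ℝ ι) 2 (volume.restrict Ω)) (a : ι) (g : Pt d → ℝ) :
    ∫ x in Ω, (c • f) x a * g x = c * ∫ x in Ω, f x a * g x := by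
  rw [← integral_const_mul]
  refine integral_congr_ae ?_
  filter_upwards [Lp.coeFn_smul c f] with x hx
  simp only [hx, Pi.smul_apply, PiLp.smul_apply, smul_eq_mul, mul_assoc]

theorem HasWeakGradient.add {Φ Ψ : L2Mat Ω} {G G' : L2Ten Ω} (hΦ : HasWeakGradient Φ G)
    (hΨ : HasWeakGradient Ψ G') : HasWeakGradient (Φ + Ψ) (G + G') := by
  intro φ h k i j
  rw [integral_coord_add Φ Ψ _ (h.continuous_pderiv k) (h.hasCompactSupport_pderiv k),
    integral_coord_add G G' _ h.contDiff.continuous h.hasCompactSupport,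
    hΦ φ h k i j, hΨ φ h k i j, neg_add]

theorem HasWeakGradient.smul {Φ : L2Mat Ω} {G : L2Ten Ω} (c : ℝ) (hΦ : HasWeakGradient Φ G) :
    HasWeakGradient (c • Φ) (c • G) := by
  intro φ h k i j
  rw [integral_coord_smul, integral_coord_smul, hΦ φ h k i j, mul_neg]

end helpers

/-- `H(Ω) = {Φ ∈ L²(Ω)^{d×d} : div Φ = 0}`, with the scalar product of `L²`. -/
def HSpace {d : ℕ} (Ω : Set (Pt d)) : Submodule ℝ (L2Mat Ω) where
  carrier := {Φ | IsDivFree Φ}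
  zero_mem' := isDivFree_zero
  add_mem' := fun hΦ hΨ => hΦ.add hΨ
  smul_mem' := fun c _ hΦ => hΦ.smul c

/-- `W^{1,2}(Ω)^{d×d}`, as the space of pairs `(Φ, ∇Φ)` of an `L²` field and its weak gradient in
`L²` (the gradient is determined by the field). As a subspace of the Hilbert sum of `L²` spaces
it carries the scalar product `(Φ, Ξ) + (∇Φ, ∇Ξ)`. -/
def Sobolev {d : ℕ} (Ω : Set (Pt d)) : Submodule ℝ (WithLp 2 (L2Mat Ω × L2Ten Ω)) where
  carrier := {p | HasWeakGradient p.fst p.snd}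
  zero_mem' := hasWeakGradient_zero
  add_mem' := fun hp hq => HasWeakGradient.add hp hq
  smul_mem' := fun c _ hp => HasWeakGradient.smul c hp

/-- `W(Ω) = {Φ ∈ W^{1,2}(Ω)^{d×d} : div Φ = 0}`, with the scalar product of `W^{1,2}`. -/
noncomputable def WSpace {d : ℕ} (Ω : Set (Pt d)) : Submodule ℝ (WithLp 2 (L2Mat Ω × L2Ten Ω)) :=
  Sobolev Ω ⊓ (HSpace Ω).comap (WithLp.fstₗ 2 ℝ (L2Mat Ω) (L2Ten Ω))

/-- The underlying field of an element of `W(Ω)`, as an element of `H(Ω)`. -/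
noncomputable def WSpace.field {d : ℕ} {Ω : Set (Pt d)} (Φ : WSpace Ω) : HSpace Ω := ⟨Φ.1.fst, Φ.2.2⟩

/-- The weak gradient of an element of `W(Ω)`. -/
noncomputable def WSpace.grad {d : ℕ} {Ω : Set (Pt d)} (Φ : WSpace Ω) : L2Ten Ω := Φ.1.snd

/-- `Φ` is an eigenfunction with eigenvalue `lam` of the problem
`(∇Φ, ∇Ξ) + (Φ, Ξ) = lam (Φ, Ξ)` for all `Ξ ∈ W(Ω)`. -/
def IsEigenfunction {d : ℕ} {Ω : Set (Pt d)} (lam : ℝ) (Φ : WSpace Ω) : Prop :=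
  Φ ≠ 0 ∧ ∀ Ξ : WSpace Ω,
    inner ℝ (WSpace.grad Φ) (WSpace.grad Ξ) + inner ℝ (WSpace.field Φ) (WSpace.field Ξ) =
      lam * inner ℝ (WSpace.field Φ) (WSpace.field Ξ)

/-- An orthogonal basis of an inner product space: a sequence of nonzero, pairwise orthogonal
vectors whose linear span is dense. -/
def IsOrthogonalBasis {E : Type*} [NormedAddCommGroup E] [InnerProductSpace ℝ E]
    (v : ℕ → E) : Prop :=
  (∀ j, v j ≠ 0) ∧ (Pairwise fun i j => inner ℝ (v i) (v j) = 0) ∧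
    (Submodule.span ℝ (Set.range v)).topologicalClosure = ⊤

/-- An orthonormal basis of an inner product space: an orthonormal sequence whose linear span is
dense. -/
def IsOrthonormalBasis {E : Type*} [NormedAddCommGroup E] [InnerProductSpace ℝ E]
    (v : ℕ → E) : Prop :=
  Orthonormal ℝ v ∧ (Submodule.span ℝ (Set.range v)).topologicalClosure = ⊤

end DivFree

/-! ### Spectral theory of strictly positive compact operators -/

section Spectral

/-! Let `J` be the embedding of `W(Ω)` into `L²`. The eigenvalue equation reads `⟪v, w⟫ = λ ⟪J v, J
w⟫` in the scalar product of `W(Ω)`, that is, `J* J v = λ⁻¹ v`. The space `W(Ω)` is complete and `J`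
is injective, so `J* J` is symmetric and strictly positive. Once `J` is known to be compact,
maximizing the Rayleigh quotient successively on the orthogonal complements of the eigenvectors
already found gives eigenvalues decreasing to `0` and an orthonormal system with dense span in
`W(Ω)` (`exists_orthonormal_eigenvectors`). The `λ` are the reciprocals, and rescaling makes the
images under `J` orthonormal (`exists_eigenvectors_of_isCompactOperator`). Their span is dense in
`H(Ω)` because `W(Ω)` is.

Two analytic facts remain: compactness of `J` and density of `W(Ω)` in `H(Ω)`. Both come from one
family of smoothing operators and need no extension across the boundary. A Lipschitz domain has a
finite smooth partition of unity `χ_k` and directions `e_k` such that translation along a cone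
around `e_k` keeps points in `Ω` on the support of `χ_k`. Set `S_t f = ∑ k, (χ_k f) * ρ(· + t e_k)`
with a mollifier `ρ` of radius proportional to `t`.

Compactness: `S_t` is compact, as a sum of convolutions on a bounded set, and `S_t f - f` is `O(t)`
in `L²` times the sum of the norms of `f` and its weak derivatives
(`InwardPartition.norm_smoothing_sub_le`). Hence `J` is a norm limit of compact operators.

Density: for divergence free `u`, the `k`-th piece of `S_t u` has divergence `g_k * ρ(· + t e_k)` in
`Ω`, where `g_k = ∇χ_k · u`. Were the kernels independent of `k`, the sum would vanish, since `∑
∇χ_k = 0`. The difference of the kernels `ρ(· + t e_k)` and `ρ` is a derivative along `t e_k` of a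
kernel `R_k` of `L¹` norm at most `1`, so subtracting `t e_k (g_k * R_k)` replaces each shifted
kernel by `ρ` at a cost of `O(t)` in `L²` (`InwardPartition.exists_contDiff_divFree`).

The first `d ^ 2` eigenvalues: `λ ≥ 1` because `‖J v‖ ≤ ‖v‖`. Constant fields have Rayleigh quotient
`1` and form a space of dimension `d ^ 2`, so one of them is orthogonal to any fewer eigenvectors,
and the variational inequality gives `λ ≤ 1`. -/

theorem tendsto_zero_of_orthonormal_of_isCompactOperator {E : Type*}
    [NormedAddCommGroup E] [InnerProductSpace ℝ E] {T : E →L[ℝ] E}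
    (hc : IsCompactOperator T) {v : ℕ → E} (hv : Orthonormal ℝ v) {c : ℕ → ℝ}
    (hTv : ∀ n, T (v n) = c n • v n) (hc0 : ∀ n, 0 ≤ c n) (hanti : Antitone c) :
    Tendsto c atTop (𝓝 0) := by
  have hbdd : BddBelow (Set.range c) := ⟨0, by rintro _ ⟨n, rfl⟩; exact hc0 n⟩
  have hlim := tendsto_atTop_ciInf hanti hbdd
  set m := ⨅ n, c n
  have hm : ∀ n, m ≤ c n := fun n => ciInf_le hbdd n
  have hm0 : 0 ≤ m := le_ciInf hc0
  rcases hm0.eq_or_lt with h | h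
  · rwa [← h] at hlim
  exfalso
  obtain ⟨K, hK, hsub⟩ := hc.image_closedBall_subset_compact (f := (T : E →ₗ[ℝ] E)) 1
  have hmem : ∀ n, T (v n) ∈ K := fun n =>
    hsub ⟨v n, by simp [hv.1 n], rfl⟩
  obtain ⟨a, _, φ, hφ, hφa⟩ := hK.tendsto_subseq hmem
  have hcau := hφa.cauchySeq
  rw [Metric.cauchySeq_iff] at hcau
  obtain ⟨N, hN⟩ := hcau m h
  have h1 := hN N le_rfl (N + 1) (Nat.le_succ N)
  have hne : φ N ≠ φ (N + 1) := (hφ (Nat.lt_succ_self N)).ne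
  -- The images of distinct `v i` are orthogonal of norm at least `m`, so they stay at least `m`
  -- apart and no subsequence of them is Cauchy.
  have h2 : ‖T (v (φ N)) - T (v (φ (N + 1)))‖ ^ 2 = c (φ N) ^ 2 + c (φ (N + 1)) ^ 2 := by
    rw [hTv, hTv, norm_sub_sq_real, norm_smul, norm_smul, hv.1, hv.1, inner_smul_left,
      inner_smul_right, hv.2 hne]
    simp
  rw [dist_eq_norm] at h1
  have h3 : ‖T (v (φ N)) - T (v (φ (N + 1)))‖ ^ 2 < m ^ 2 := by
    have : ‖T (v (φ N)) - T (v (φ (N + 1)))‖ < m := h1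
    gcongr
  have h4 := hm (φ N)
  nlinarith [sq_nonneg (c (φ (N + 1)))]

variable {E : Type*} [NormedAddCommGroup E] [InnerProductSpace ℝ E] [CompleteSpace E]

/-- The norm of a nonzero positive compact operator is an eigenvalue. -/
theorem hasEigenvalue_norm_of_isCompactOperator {T : E →L[ℝ] E} (hc : IsCompactOperator T)
    (hs : (T : E →ₗ[ℝ] E).IsSymmetric) (hpos : ∀ x, 0 ≤ inner ℝ (T x) x) (h0 : T ≠ 0) :
    Module.End.HasEigenvalue (T : E →ₗ[ℝ] E) ‖T‖ := by
  have hn : ‖T‖ ≠ 0 := by simpa using h0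
  have : Nontrivial E := by
    by_contra h
    rw [not_nontrivial_iff_subsingleton] at h
    exact h0 (Subsingleton.elim _ _)
  -- Fredholm alternative: otherwise `‖T‖` is in the resolvent set and the Rayleigh quotients stay
  -- below `‖T‖ - ε`. For a positive operator this contradicts `‖T‖` being the supremum of their
  -- absolute values.
  refine (IsCompactOperator.hasEigenvalue_or_mem_resolventSet hc hn).resolve_right fun h => ?_
  obtain ⟨ε, hε, hle⟩ := T.rayleighQuotient_le_of_norm_mem_resolventSet (𝕜 := ℝ) h
  have := T.norm_eq_iSup_rayleighQuotient hs
  have h2 : ⨆ x, |T.rayleighQuotient x| ≤ ‖T‖ - ε := by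
    refine ciSup_le fun x => ?_
    rw [abs_of_nonneg]
    · exact hle x
    · exact div_nonneg (hpos x) (by positivity)
  linarith

/-- In the orthogonal complement of finitely many eigenvectors, a positive compact operator has
an eigenvector which maximizes the Rayleigh quotient. -/
theorem exists_maximal_eigenvector {T : E →L[ℝ] E} (hc : IsCompactOperator T)
    (hs : (T : E →ₗ[ℝ] E).IsSymmetric) (hpos : ∀ x, x ≠ 0 → 0 < inner ℝ (T x) x)
    (hinf : ¬ FiniteDimensional ℝ E) (s : Finset E) (hev : ∀ y ∈ s, ∃ c : ℝ, T y = c • y) :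
    ∃ v : E, ∃ c : ℝ, ‖v‖ = 1 ∧ T v = c • v ∧ (∀ y ∈ s, inner ℝ y v = 0) ∧
      ∀ x, (∀ y ∈ s, inner ℝ y x = 0) → inner ℝ (T x) x ≤ c * ‖x‖ ^ 2 := by
  have hmem : ∀ x, x ∈ (Submodule.span ℝ (s : Set E))ᗮ ↔ ∀ y ∈ s, inner ℝ y x = 0 := by
    intro x
    rw [Submodule.mem_orthogonal]
    refine ⟨fun h y hy => h y (Submodule.subset_span hy), fun h u hu => ?_⟩
    induction hu using Submodule.span_induction with
    | mem y hy => exact h y hy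
    | zero => simp
    | add a b _ _ ha hb => rw [inner_add_left, ha, hb, add_zero]
    | smul a b _ hb => rw [inner_smul_left, hb, mul_zero]
  set V := (Submodule.span ℝ (s : Set E))ᗮ with hV
  have hinv : ∀ x ∈ V, (T : E →ₗ[ℝ] E) x ∈ V := by
    intro x hx
    rw [hmem] at hx ⊢
    intro y hy
    obtain ⟨c, hc⟩ := hev y hy
    have h1 : inner ℝ ((T : E →ₗ[ℝ] E) y) x = inner ℝ y ((T : E →ₗ[ℝ] E) x) := hs y x
    rw [← h1]
    change inner ℝ (T y) x = 0
    rw [hc, inner_smul_left, hx y hy, mul_zero]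
  -- By symmetry the complement `V` of eigenvectors is invariant. The restriction `S` attains its
  -- norm as an eigenvalue, and `‖S‖` bounds the Rayleigh quotient on `V` by Cauchy–Schwarz.
  let S : V →L[ℝ] V := T.restrict hinv
  have hSc : IsCompactOperator S := hc.restrict' (f := (T : E →ₗ[ℝ] E)) hinv
  have hSs : (S : V →ₗ[ℝ] V).IsSymmetric := hs.restrict_invariant hinv
  have hSpos : ∀ x : V, 0 ≤ inner ℝ (S x) x := by
    intro x
    by_cases hx : (x : E) = 0
    · have : x = 0 := Subtype.ext hx
      simp [this]
    · exact (hpos x hx).le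
  have hne : V ≠ ⊥ := by
    intro h
    apply hinf
    have : Submodule.span ℝ (s : Set E) = ⊤ := by
      rw [← Submodule.orthogonal_eq_bot_iff]
      exact h
    have h2 : FiniteDimensional ℝ (Submodule.span ℝ (s : Set E)) :=
      FiniteDimensional.span_finset ℝ s
    rw [this] at h2
    exact Module.Finite.equiv Submodule.topEquiv
  obtain ⟨x₀, hx₀, hx₀'⟩ := Submodule.exists_mem_ne_zero_of_ne_bot hne
  have hS0 : S ≠ 0 := by
    intro h
    have h1 := hpos x₀ hx₀'
    have h2 : inner ℝ (S ⟨x₀, hx₀⟩) (⟨x₀, hx₀⟩ : V) = 0 := by rw [h]; simp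
    exact h1.ne' h2
  obtain ⟨v, hv⟩ := (hasEigenvalue_norm_of_isCompactOperator hSc hSs hSpos hS0).exists_hasEigenvector
  have hv0 : (v : E) ≠ 0 := fun h => hv.2 (Subtype.ext h)
  have hvT : T (v : E) = ‖S‖ • (v : E) := congrArg Subtype.val hv.apply_eq_smul
  refine ⟨‖(v : E)‖⁻¹ • (v : E), ‖S‖, ?_, ?_, ?_, ?_⟩
  · rw [norm_smul, norm_inv, norm_norm, inv_mul_cancel₀ (norm_ne_zero_iff.2 hv0)]
  · rw [map_smul, hvT, smul_comm]
  · exact (hmem _).1 (V.smul_mem _ v.2)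
  · intro x hx
    have hxV : x ∈ V := (hmem x).2 hx
    calc inner ℝ (T x) x = inner ℝ (S ⟨x, hxV⟩) (⟨x, hxV⟩ : V) := rfl
      _ ≤ ‖S ⟨x, hxV⟩‖ * ‖(⟨x, hxV⟩ : V)‖ := real_inner_le_norm _ _
      _ ≤ ‖S‖ * ‖(⟨x, hxV⟩ : V)‖ * ‖(⟨x, hxV⟩ : V)‖ := by gcongr; exact S.le_opNorm _
      _ = ‖S‖ * ‖x‖ ^ 2 := by rw [Submodule.coe_norm]; ring

/-- A sequence chosen step by step, each term depending on the finite set of the previous ones. -/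
theorem exists_seq_of_forall_finset {α : Type*} [DecidableEq α] (P : Finset α → α → Prop)
    (Q : α → Prop) (h : ∀ s : Finset α, (∀ x ∈ s, Q x) → ∃ y, P s y ∧ Q y) :
    ∃ f : ℕ → α, ∀ n, P ((Finset.range n).image f) (f n) ∧ Q (f n) := by
  classical
  have : Nonempty α := ⟨(h ∅ (by simp)).choose⟩
  choose! g hg using h
  -- The recursion carries the set of all earlier choices together with the invariant `Q`, under
  -- which the next choice is possible.
  let F : ℕ → {s : Finset α // ∀ x ∈ s, Q x} := fun n => n.rec ⟨∅, by simp⟩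
    fun _ s => ⟨insert (g s.1) s.1, by
      intro x hx
      rcases Finset.mem_insert.1 hx with rfl | hx
      · exact (hg s.1 s.2).2
      · exact s.2 x hx⟩
  have hF : ∀ n, (F n).1 = (Finset.range n).image fun k => g (F k).1 := by
    intro n
    induction n with
    | zero => rfl
    | succ n ih =>
      rw [Finset.range_add_one, Finset.image_insert, ← ih]
  refine ⟨fun n => g (F n).1, fun n => ?_⟩
  rw [← hF n]
  exact hg _ (F n).2

/-- The eigenvectors of a strictly positive compact operator, in the order of decreasing
eigenvalues, with the variational characterization of the eigenvalues. -/
theorem exists_orthonormal_eigenvectors {T : E →L[ℝ] E} (hc : IsCompactOperator T)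
    (hs : (T : E →ₗ[ℝ] E).IsSymmetric) (hpos : ∀ x, x ≠ 0 → 0 < inner ℝ (T x) x)
    (hinf : ¬ FiniteDimensional ℝ E) :
    ∃ (v : ℕ → E) (c : ℕ → ℝ), Orthonormal ℝ v ∧ (∀ n, T (v n) = c n • v n) ∧ (∀ n, 0 < c n) ∧
      Antitone c ∧ Tendsto c atTop (𝓝 0) ∧
      (∀ n x, (∀ i < n, inner ℝ (v i) x = 0) → inner ℝ (T x) x ≤ c n * ‖x‖ ^ 2) ∧
      (Submodule.span ℝ (Set.range v)).topologicalClosure = ⊤ := by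
  classical
  obtain ⟨v, hv⟩ := exists_seq_of_forall_finset
    (P := fun s v => ‖v‖ = 1 ∧ (∀ y ∈ s, inner ℝ y v = 0) ∧
      ∃ c : ℝ, T v = c • v ∧ ∀ x, (∀ y ∈ s, inner ℝ y x = 0) → inner ℝ (T x) x ≤ c * ‖x‖ ^ 2)
    (Q := fun v => ∃ c : ℝ, T v = c • v) (by
      intro s hev
      obtain ⟨v, c, h1, h2, h3, h4⟩ := exists_maximal_eigenvector hc hs hpos hinf s hev
      exact ⟨v, ⟨h1, h3, c, h2, h4⟩, c, h2⟩)
  choose c hc1 hc2 using fun n => (hv n).1.2.2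
  have hlt : ∀ i j, i < j → inner ℝ (v i) (v j) = 0 := fun i j hij =>
    (hv j).1.2.1 _ (Finset.mem_image_of_mem _ (Finset.mem_range.2 hij))
  have hon : Orthonormal ℝ v := by
    refine ⟨fun n => (hv n).1.1, fun i j hij => ?_⟩
    rcases hij.lt_or_gt with h | h
    · exact hlt i j h
    · rw [real_inner_comm]; exact hlt j i h
  have hmax : ∀ n x, (∀ i < n, inner ℝ (v i) x = 0) → inner ℝ (T x) x ≤ c n * ‖x‖ ^ 2 := by
    intro n x hx
    refine hc2 n x fun y hy => ?_
    obtain ⟨i, hi, rfl⟩ := Finset.mem_image.1 hy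
    exact hx i (Finset.mem_range.1 hi)
  have hval : ∀ n, inner ℝ (T (v n)) (v n) = c n := by
    intro n
    rw [hc1, inner_smul_left, real_inner_self_eq_norm_sq, hon.1]
    simp
  have hc0 : ∀ n, 0 < c n := fun n => by
    rw [← hval]
    exact hpos _ (hon.ne_zero n)
  -- For `i ≤ j` the vector `v j` is admissible in the maximization that produced `c i`.
  have hanti : Antitone c := by
    intro i j hij
    rw [← hval j]
    have := hmax i (v j) fun k hk => hlt k j (hk.trans_le hij)
    rwa [hon.1, one_pow, mul_one] at this
  have hlim := tendsto_zero_of_orthonormal_of_isCompactOperator hc hon hc1 (fun n => (hc0 n).le) hanti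
  refine ⟨v, c, hon, hc1, hc0, hanti, hlim, hmax, ?_⟩
  -- A vector orthogonal to every `v n` is admissible at every stage, so its quadratic form is at
  -- most `c n * ‖x‖ ^ 2 → 0`, and strict positivity forces it to be zero.
  rw [Submodule.topologicalClosure_eq_top_iff, Submodule.eq_bot_iff]
  intro x hx
  by_contra hx0
  have h1 : ∀ n, inner ℝ (T x) x ≤ c n * ‖x‖ ^ 2 := fun n =>
    hmax n x fun i _ => hx _ (Submodule.subset_span ⟨i, rfl⟩)
  have h2 : Tendsto (fun n => c n * ‖x‖ ^ 2) atTop (𝓝 0) := by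
    simpa using hlim.mul_const (‖x‖ ^ 2)
  exact (hpos x hx0).not_ge (ge_of_tendsto' h2 h1)

end Spectral

namespace DivFree

/-! ### Inward directions and partitions of unity on Lipschitz domains -/

section Geometry

open Set Metric

variable {d : ℕ} {Ω : Set (Pt d)}

/-- Near each point of the closure of a Lipschitz domain there is a direction such that the domain
is stable under small translations along a cone around this direction. -/
theorem IsBoundedLipschitzDomain.exists_inward_direction (hΩ : IsBoundedLipschitzDomain Ω)
    {x : Pt d} (hx : x ∈ closure Ω) :
    ∃ (e : Pt d) (r t₀ c : ℝ), ‖e‖ ≤ 1 ∧ 0 < r ∧ 0 < t₀ ∧ 0 < c ∧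
      ∀ (t s : ℝ) (z y : Pt d), 0 < t → t ≤ t₀ → ‖z - t • e‖ ≤ c * t → 0 ≤ s → s ≤ 1 → y ∈ Ω →
        y + s • z ∈ ball x r → y + s • z ∈ Ω := by
  by_cases hxΩ : x ∈ Ω
  -- At an interior point a small ball lies in `Ω`, so the zero direction serves.
  · obtain ⟨r, hr, hsub⟩ := Metric.isOpen_iff.1 hΩ.isOpen x hxΩ
    exact ⟨0, r, 1, 1, by simp, hr, one_pos, one_pos, fun t s z y _ _ _ _ _ _ h => hsub h⟩
  have hfr : x ∈ frontier Ω := by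
    rw [frontier, hΩ.isOpen.interior_eq]
    exact ⟨hx, hxΩ⟩
  obtain ⟨e, γ, K, r, he, hγ, hr, hgraph⟩ := hΩ.lipschitz_boundary x hfr
  have hK : (0 : ℝ) ≤ K := K.2
  have hee : inner ℝ e e = (1 : ℝ) := by rw [real_inner_self_eq_norm_sq, he, one_pow]
  -- Since `c ≤ 1`, `‖z‖ ≤ 2 * t ≤ r / 2`, so `y` lies in the full ball if `y + s • z` lies in the
  -- half ball. The translation raises the last coordinate by at least `s * (1 - c) * t`, and moves
  -- the projection by at most `2 * c * s * t`, so the graph rises by at most `2 * K * c * s * t`.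
  -- The choice `(2 * K + 2) * c = 1` makes the first dominate.
  refine ⟨e, r / 2, r / 4, 1 / (2 * K + 2), he.le, by positivity, by positivity, by positivity, ?_⟩
  intro t s z y ht ht₀ hz hs0 hs1 hy hyz
  set c : ℝ := 1 / (2 * K + 2) with hc
  have hcpos : 0 < c := by positivity
  have hcK : (2 * K + 2) * c = 1 := by rw [hc]; field_simp
  obtain ⟨w, rfl⟩ : ∃ w, z = t • e + w := ⟨z - t • e, by abel⟩
  rw [add_sub_cancel_left] at hz
  have hc1 : c ≤ 1 := by nlinarith
  have hzn : ‖t • e + w‖ ≤ 2 * t := by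
    calc ‖t • e + w‖ ≤ ‖t • e‖ + ‖w‖ := norm_add_le _ _
      _ ≤ t + c * t := by rw [norm_smul, he, Real.norm_eq_abs, abs_of_pos ht, mul_one]; gcongr
      _ ≤ 2 * t := by nlinarith
  have hszn : ‖s • (t • e + w)‖ ≤ r / 2 := by
    rw [norm_smul, Real.norm_eq_abs, abs_of_nonneg hs0]
    calc s * ‖t • e + w‖ ≤ 1 * (2 * t) := by gcongr
      _ ≤ r / 2 := by linarith
  have hyball : y ∈ ball x r := by
    rw [mem_ball, dist_eq_norm] at hyz ⊢
    have : y - x = (y + s • (t • e + w) - x) - s • (t • e + w) := by abel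
    rw [this]
    calc _ ≤ ‖y + s • (t • e + w) - x‖ + ‖s • (t • e + w)‖ := norm_sub_le _ _
      _ < r := by linarith
  have hball : y + s • (t • e + w) ∈ ball x r := ball_subset_ball (by linarith) hyz
  have hyγ := (hgraph y hyball).1 hy
  rw [hgraph _ hball]
  have hinner : |inner ℝ e w| ≤ c * t := by
    calc |inner ℝ e w| ≤ ‖e‖ * ‖w‖ := abs_real_inner_le_norm _ _
      _ ≤ c * t := by rw [he, one_mul]; exact hz
  have hlast : inner ℝ e (y + s • (t • e + w)) = inner ℝ e y + s * (t + inner ℝ e w) := by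
    rw [inner_add_right, inner_smul_right, inner_add_right, inner_smul_right, hee, mul_one]
  have hproj : (y + s • (t • e + w) - inner ℝ e (y + s • (t • e + w)) • e) -
      (y - inner ℝ e y • e) = s • (w - inner ℝ e w • e) := by
    rw [hlast]
    module
  have hdist := hγ.dist_le_mul (y + s • (t • e + w) - inner ℝ e (y + s • (t • e + w)) • e)
    (y - inner ℝ e y • e)
  rw [dist_eq_norm (_ - _), hproj, Real.dist_eq, norm_smul, Real.norm_eq_abs, abs_of_nonneg hs0]
    at hdist
  have hw : ‖w - inner ℝ e w • e‖ ≤ 2 * (c * t) := by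
    calc _ ≤ ‖w‖ + ‖inner ℝ e w • e‖ := norm_sub_le _ _
      _ ≤ c * t + c * t := by
        rw [norm_smul, he, mul_one, Real.norm_eq_abs]; gcongr
      _ = _ := by ring
  have h1 := (abs_le.1 hdist).2
  have h2 : K * (s * ‖w - inner ℝ e w • e‖) ≤ K * (s * (2 * (c * t))) := by gcongr
  have h3 := (abs_le.1 hinner).1
  have h4 : K * (s * (2 * (c * t))) ≤ s * (t - c * t) := by
    have : 2 * K * c ≤ 1 - c := by nlinarith
    calc K * (s * (2 * (c * t))) = (2 * K * c) * (s * t) := by ring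
      _ ≤ (1 - c) * (s * t) := by gcongr
      _ = _ := by ring
  have h5 : s * (t - c * t) ≤ s * (t + inner ℝ e w) := by gcongr; linarith
  linarith

/-- A smooth partition of unity on `Ω`, together with, for each member, a direction such that
translating along the cone `{z | ‖z - t • e k‖ ≤ c * t}` does not leave `Ω` on the support of the
member. -/
structure InwardPartition (Ω : Set (Pt d)) (ι : Type) [Fintype ι] where
  toFun : ι → Pt d → ℝ
  dir : ι → Pt d
  maxTime : ℝ
  aperture : ℝ
  maxTime_pos : 0 < maxTime
  aperture_pos : 0 < aperture
  contDiff : ∀ k, ContDiff ℝ ∞ (toFun k)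
  hasCompactSupport : ∀ k, HasCompactSupport (toFun k)
  norm_dir_le : ∀ k, ‖dir k‖ ≤ 1
  sum_eq_one : ∀ x ∈ Ω, ∑ k, toFun k x = 1
  add_smul_mem : ∀ (k : ι) (t s : ℝ) (z y : Pt d), 0 < t → t ≤ maxTime →
    ‖z - t • dir k‖ ≤ aperture * t → 0 ≤ s → s ≤ 1 → y ∈ Ω →
      y + s • z ∈ tsupport (toFun k) → y + s • z ∈ Ω

theorem IsBoundedLipschitzDomain.exists_inwardPartition (hΩ : IsBoundedLipschitzDomain Ω) :
    ∃ (ι : Type) (_ : Fintype ι), Nonempty (InwardPartition Ω ι) := by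
  have hcomp : IsCompact (closure Ω) := hΩ.isBounded.isCompact_closure
  have hloc : ∀ x : Pt d, ∃ (e : Pt d) (r t₀ c : ℝ), ‖e‖ ≤ 1 ∧ 0 < r ∧ 0 < t₀ ∧ 0 < c ∧
      (x ∈ closure Ω → ∀ (t s : ℝ) (z y : Pt d), 0 < t → t ≤ t₀ → ‖z - t • e‖ ≤ c * t → 0 ≤ s →
        s ≤ 1 → y ∈ Ω → y + s • z ∈ ball x r → y + s • z ∈ Ω) := by
    intro x
    by_cases hx : x ∈ closure Ω
    · obtain ⟨e, r, t₀, c, h1, h2, h3, h4, h5⟩ := hΩ.exists_inward_direction hx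
      exact ⟨e, r, t₀, c, h1, h2, h3, h4, fun _ => h5⟩
    · exact ⟨0, 1, 1, 1, by simp, one_pos, one_pos, one_pos, fun h => absurd h hx⟩
  choose e r t₀ c he hr ht hc hmain using hloc
  obtain ⟨T, hT, hcov⟩ := hcomp.elim_nhds_subcover (fun x => ball x (r x))
    fun x _ => ball_mem_nhds x (hr x)
  obtain ⟨f, hf⟩ := SmoothPartitionOfUnity.exists_isSubordinate (modelWithCornersSelf ℝ (Pt d))
    (s := closure Ω) isClosed_closure (fun i : T => ball (i : Pt d) (r i)) (fun i => isOpen_ball)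
    (by rwa [iUnion_subtype])
  -- The finite subcover has a common positive time and aperture; the value `1` serves if it is
  -- empty.
  have hmin : ∀ g : Pt d → ℝ, (∀ x, 0 < g x) → ∃ δ > 0, ∀ x ∈ T, δ ≤ g x := by
    intro g hg
    obtain rfl | hne := T.eq_empty_or_nonempty
    · exact ⟨1, one_pos, by simp⟩
    · exact ⟨T.inf' hne g, (Finset.lt_inf'_iff hne).2 fun x _ => hg x,
        fun x hx => Finset.inf'_le g hx⟩
  obtain ⟨t₁, ht₁, ht₁'⟩ := hmin t₀ ht
  obtain ⟨c₁, hc₁, hc₁'⟩ := hmin c hc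
  refine ⟨T, inferInstance, ⟨⟨fun k => f k, fun k => e k, t₁, c₁, ht₁, hc₁, ?_, ?_, ?_, ?_, ?_⟩⟩⟩
  · intro k
    exact (f k).contMDiff.contDiff
  · intro k
    exact (isCompact_closedBall (k : Pt d) (r k)).of_isClosed_subset (isClosed_tsupport _)
      ((hf k).trans ball_subset_closedBall)
  · intro k
    exact he _
  · intro x hx
    rw [← finsum_eq_sum_of_fintype]
    exact f.sum_eq_one (subset_closure hx)
  · intro k t s z y h1 h2 h3 h4 h5 h6 h7
    exact hmain k (hT _ k.2) t s z y h1 (h2.trans (ht₁' _ k.2))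
      (h3.trans (by have := hc₁' _ k.2; gcongr)) h4 h5 h6 (hf k h7)

end Geometry

/-! ### Convolution with smooth kernels and Young's inequality -/

section Convolution

open scoped ENNReal

variable {d : ℕ}

/-- The convolution of `f` with the kernel `k`, with respect to the measure `ν`. -/
noncomputable def conv (ν : Measure (Pt d)) (f k : Pt d → ℝ) (x : Pt d) : ℝ :=
  ∫ y, f y * k (x - y) ∂ν

theorem exists_bound_of_continuous {F : Type*} [NormedAddCommGroup F] {k : Pt d → F}
    (hk : Continuous k) (hc : HasCompactSupport k) : ∃ C, 0 ≤ C ∧ ∀ x, ‖k x‖ ≤ C := by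
  obtain ⟨C, hC⟩ := hc.exists_bound_of_continuous hk
  exact ⟨C, (norm_nonneg _).trans (hC 0), hC⟩

variable {ν : Measure (Pt d)} {f k : Pt d → ℝ}

theorem integrable_mul_kernel (hf : Integrable f ν) (hk : Continuous k)
    (hc : HasCompactSupport k) (x : Pt d) : Integrable (fun y => f y * k (x - y)) ν := by
  obtain ⟨C, _, hC⟩ := exists_bound_of_continuous hk hc
  exact hf.mul_bdd (c := C) (by fun_prop) (.of_forall fun y => hC _)

theorem continuous_conv (hf : Integrable f ν) (hk : Continuous k) (hc : HasCompactSupport k) :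
    Continuous (conv ν f k) := by
  obtain ⟨C, _, hC⟩ := exists_bound_of_continuous hk hc
  refine continuous_of_dominated (bound := fun y => ‖f y‖ * C) (fun x => ?_) (fun x => ?_)
    (hf.norm.mul_const _) (.of_forall fun y => by fun_prop)
  · exact (integrable_mul_kernel hf hk hc x).aestronglyMeasurable
  · refine .of_forall fun y => ?_
    rw [norm_mul]
    gcongr
    exact hC _

theorem hasFDerivAt_conv (hf : Integrable f ν) (hk : ContDiff ℝ 1 k) (hc : HasCompactSupport k)
    (x : Pt d) : HasFDerivAt (conv ν f k) (∫ y, f y • fderiv ℝ k (x - y) ∂ν) x := by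
  have hk' : Continuous (fderiv ℝ k) := hk.continuous_fderiv (by simp)
  obtain ⟨C, _, hC⟩ := exists_bound_of_continuous hk' (hc.fderiv (𝕜 := ℝ))
  refine hasFDerivAt_integral_of_dominated_of_fderiv_le (𝕜 := ℝ) (s := Set.univ)
    (bound := fun y => ‖f y‖ * C) (F := fun x y => f y * k (x - y))
    (F' := fun x y => f y • fderiv ℝ k (x - y)) univ_mem (.of_forall fun z => ?_)
    (integrable_mul_kernel hf hk.continuous hc x) ?_ (.of_forall fun y z _ => ?_)
    (hf.norm.mul_const _) (.of_forall fun y z _ => ?_)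
  · exact (integrable_mul_kernel hf hk.continuous hc z).aestronglyMeasurable
  · exact hf.aestronglyMeasurable.smul (by fun_prop : Continuous _).aestronglyMeasurable
  · rw [norm_smul]
    gcongr
    exact hC _
  · have h1 : HasFDerivAt k (fderiv ℝ k (z - y)) (z - y) :=
      (hk.differentiable (by simp) _).hasFDerivAt
    have h2 : HasFDerivAt (fun z => k (z - y)) (fderiv ℝ k (z - y)) z := by
      exact (h1.comp z ((hasFDerivAt_id z).sub_const y) :)
    exact h2.const_mul (f y)

theorem contDiff_conv (hf : Integrable f ν) (hk : ContDiff ℝ 1 k) (hc : HasCompactSupport k) :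
    ContDiff ℝ 1 (conv ν f k) := by
  have hk' : Continuous (fderiv ℝ k) := hk.continuous_fderiv (by simp)
  obtain ⟨C, _, hC⟩ := exists_bound_of_continuous hk' (hc.fderiv (𝕜 := ℝ))
  rw [contDiff_one_iff_fderiv]
  refine ⟨fun x => (hasFDerivAt_conv hf hk hc x).differentiableAt, ?_⟩
  rw [funext fun x => (hasFDerivAt_conv hf hk hc x).fderiv]
  refine continuous_of_dominated (bound := fun y => ‖f y‖ * C) (fun x => ?_) (fun x => ?_)
    (hf.norm.mul_const _) (.of_forall fun y => by fun_prop)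
  · exact hf.aestronglyMeasurable.smul (by fun_prop : Continuous _).aestronglyMeasurable
  · refine .of_forall fun y => ?_
    rw [norm_smul]
    gcongr
    exact hC _

theorem fderiv_conv_apply (hf : Integrable f ν) (hk : ContDiff ℝ 1 k) (hc : HasCompactSupport k)
    (x v : Pt d) : fderiv ℝ (conv ν f k) x v = conv ν f (fun z => fderiv ℝ k z v) x := by
  have hk' : Continuous (fderiv ℝ k) := hk.continuous_fderiv (by simp)
  obtain ⟨C, _, hC⟩ := exists_bound_of_continuous hk' (hc.fderiv (𝕜 := ℝ))
  rw [(hasFDerivAt_conv hf hk hc x).fderiv, ContinuousLinearMap.integral_apply]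
  · rfl
  · exact hf.smul_bdd (C := C) (by fun_prop : Continuous _).aestronglyMeasurable
      (.of_forall fun y => hC _)

/-- Young's inequality for `L¹ * L²`: split `|k|` as `|k| ^ (1/2) * |k| ^ (1/2)`, apply
Cauchy–Schwarz in `y`, then integrate in `x` by Tonelli and translation invariance. The condition `ν
≤ volume` bounds the mass of a translated kernel under `ν` by its full `L¹` norm. -/
theorem lintegral_conv_sq_le [SFinite ν] (hν : ν ≤ volume) (hf : AEMeasurable f ν)
    (hk : Continuous k) :
    ∫⁻ x, ‖conv ν f k x‖ₑ ^ 2 ≤ (∫⁻ x, ‖k x‖ₑ) ^ 2 * ∫⁻ y, ‖f y‖ₑ ^ 2 ∂ν := by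
  have hpt : ∀ x, ‖conv ν f k x‖ₑ ^ 2 ≤
      (∫⁻ x, ‖k x‖ₑ) * ∫⁻ y, ‖f y‖ₑ ^ 2 * ‖k (x - y)‖ₑ ∂ν := by
    intro x
    have hkm : Measurable fun y => ‖k (x - y)‖ₑ :=
      (by fun_prop : Continuous fun y => k (x - y)).measurable.enorm
    have h1 : ‖conv ν f k x‖ₑ ≤ ∫⁻ y, (‖k (x - y)‖ₑ ^ (1 / 2 : ℝ)) *
        ((‖f y‖ₑ ^ 2 * ‖k (x - y)‖ₑ) ^ (1 / 2 : ℝ)) ∂ν := by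
      refine (enorm_integral_le_lintegral_enorm _).trans_eq (lintegral_congr fun y => ?_)
      rw [ENNReal.mul_rpow_of_nonneg _ _ (by norm_num), mul_left_comm,
        ← ENNReal.rpow_add_of_nonneg _ _ (by norm_num) (by norm_num), enorm_mul,
        ← ENNReal.rpow_natCast, ← ENNReal.rpow_mul]
      norm_num
    have h2 := ENNReal.lintegral_mul_norm_pow_le (μ := ν) hkm.aemeasurable
      (g := fun y => ‖f y‖ₑ ^ 2 * ‖k (x - y)‖ₑ) (by fun_prop) (p := 1 / 2) (q := 1 / 2)
      (by norm_num) (by norm_num) (by norm_num)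
    have h3 : ∫⁻ y, ‖k (x - y)‖ₑ ∂ν ≤ ∫⁻ x, ‖k x‖ₑ := by
      calc ∫⁻ y, ‖k (x - y)‖ₑ ∂ν ≤ ∫⁻ y, ‖k (x - y)‖ₑ := lintegral_mono' hν le_rfl
        _ = _ := lintegral_sub_left_eq_self (μ := volume) (fun y => ‖k y‖ₑ) x
    calc ‖conv ν f k x‖ₑ ^ 2
        ≤ ((∫⁻ y, ‖k (x - y)‖ₑ ∂ν) ^ (1 / 2 : ℝ) *
          (∫⁻ y, ‖f y‖ₑ ^ 2 * ‖k (x - y)‖ₑ ∂ν) ^ (1 / 2 : ℝ)) ^ 2 := by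
          gcongr
          exact h1.trans h2
      _ = (∫⁻ y, ‖k (x - y)‖ₑ ∂ν) * ∫⁻ y, ‖f y‖ₑ ^ 2 * ‖k (x - y)‖ₑ ∂ν := by
          rw [mul_pow, ← ENNReal.rpow_natCast, ← ENNReal.rpow_mul, ← ENNReal.rpow_natCast,
            ← ENNReal.rpow_mul]
          norm_num
      _ ≤ _ := by gcongr
  have hmeas : AEMeasurable (Function.uncurry fun x y : Pt d => ‖f y‖ₑ ^ 2 * ‖k (x - y)‖ₑ)
      (volume.prod ν) := by
    have h1 : AEMeasurable (fun p : Pt d × Pt d => f p.2) (volume.prod ν) := hf.comp_snd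
    have h2 : Measurable (fun p : Pt d × Pt d => k (p.1 - p.2)) := by fun_prop
    exact (h1.enorm.pow_const 2).mul h2.enorm.aemeasurable
  calc ∫⁻ x, ‖conv ν f k x‖ₑ ^ 2
      ≤ ∫⁻ x, (∫⁻ x, ‖k x‖ₑ) * ∫⁻ y, ‖f y‖ₑ ^ 2 * ‖k (x - y)‖ₑ ∂ν := lintegral_mono hpt
    _ = (∫⁻ x, ‖k x‖ₑ) * ∫⁻ x, ∫⁻ y, ‖f y‖ₑ ^ 2 * ‖k (x - y)‖ₑ ∂ν := by
        exact lintegral_const_mul'' _ hmeas.lintegral_prod_right'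
    _ = (∫⁻ x, ‖k x‖ₑ) * ∫⁻ y, (∫⁻ x, ‖f y‖ₑ ^ 2 * ‖k (x - y)‖ₑ) ∂ν := by
        rw [lintegral_lintegral_swap hmeas]
    _ = (∫⁻ x, ‖k x‖ₑ) * ∫⁻ y, (‖f y‖ₑ ^ 2 * ∫⁻ x, ‖k x‖ₑ) ∂ν := by
        congr 1
        refine lintegral_congr fun y => ?_
        rw [lintegral_const_mul _
          (by fun_prop : Continuous fun x => k (x - y)).measurable.enorm]
        congr 1
        exact lintegral_sub_right_eq_self (μ := volume) (fun y => ‖k y‖ₑ) y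
    _ = _ := by
        rw [lintegral_mul_const'' _ (by fun_prop)]
        ring

theorem eLpNorm_conv_le [SFinite ν] (hν : ν ≤ volume) (hf : AEMeasurable f ν) (hk : Continuous k) :
    eLpNorm (conv ν f k) 2 volume ≤ (∫⁻ x, ‖k x‖ₑ) * eLpNorm f 2 ν := by
  have h := lintegral_conv_sq_le hν hf hk
  rw [eLpNorm_eq_lintegral_rpow_enorm_toReal (by simp) (by simp),
    eLpNorm_eq_lintegral_rpow_enorm_toReal (by simp) (by simp)]
  simp only [ENNReal.toReal_ofNat, ENNReal.rpow_ofNat]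
  calc _ ≤ ((∫⁻ x, ‖k x‖ₑ) ^ 2 * ∫⁻ y, ‖f y‖ₑ ^ 2 ∂ν) ^ (1 / 2 : ℝ) := by gcongr
    _ = _ := by
      rw [ENNReal.mul_rpow_of_nonneg _ _ (by norm_num), ← ENNReal.rpow_natCast,
        ← ENNReal.rpow_mul]
      norm_num

end Convolution

theorem isCompactOperator_of_forall_exists {E F : Type*} [NormedAddCommGroup E] [NormedSpace ℝ E]
    [NormedAddCommGroup F] [NormedSpace ℝ F] [CompleteSpace F] {T : E →L[ℝ] F}
    (h : ∀ ε > 0, ∃ S : E →L[ℝ] F, IsCompactOperator S ∧ ∀ x, ‖T x - S x‖ ≤ ε * ‖x‖) :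
    IsCompactOperator T := by
  have hcl : IsClosed {T : E →L[ℝ] F | IsCompactOperator T} :=
    isClosed_setOfPred_isCompactOperator
  refine hcl.closure_subset_iff.2 (Set.Subset.refl _) (Metric.mem_closure_iff.2 fun ε hε => ?_)
  obtain ⟨S, hS, hle⟩ := h (ε / 2) (half_pos hε)
  refine ⟨S, hS, ?_⟩
  rw [dist_eq_norm]
  exact ((T - S).opNorm_le_bound (half_pos hε).le hle).trans_lt (half_lt_self hε)

/-! ### Convolution as a compact operator on `L²(Ω)` -/

section ConvolutionOperator

variable {d : ℕ} {Ω : Set (Pt d)}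

/-- The space `L²(Ω)` of real functions. -/
abbrev L2 (Ω : Set (Pt d)) : Type := Lp ℝ 2 (volume.restrict Ω)

theorem lintegral_enorm_eq_ofReal {k : Pt d → ℝ} (hk : Continuous k) (hc : HasCompactSupport k) :
    ∫⁻ x, ‖k x‖ₑ = ENNReal.ofReal (∫ x, ‖k x‖) :=
  (ofReal_integral_norm_eq_lintegral_enorm (hk.integrable_of_hasCompactSupport hc)).symm

theorem memLp_conv (f : L2 Ω) {k : Pt d → ℝ} (hk : Continuous k) (hc : HasCompactSupport k)
    (hf : Integrable f (volume.restrict Ω)) :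
    MemLp (conv (volume.restrict Ω) f k) 2 (volume.restrict Ω) := by
  refine ⟨(continuous_conv hf hk hc).aestronglyMeasurable, ?_⟩
  refine (eLpNorm_mono_measure _ Measure.restrict_le_self).trans_lt
    ((eLpNorm_conv_le Measure.restrict_le_self (Lp.aestronglyMeasurable f).aemeasurable hk).trans_lt ?_)
  rw [lintegral_enorm_eq_ofReal hk hc]
  exact ENNReal.mul_lt_top ENNReal.ofReal_lt_top (Lp.eLpNorm_lt_top f)

theorem memLp_translate {k : Pt d → ℝ} (hk : Continuous k) (hc : HasCompactSupport k) (x : Pt d) :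
    MemLp (fun y => k (x - y)) 2 (volume.restrict Ω) :=
  (hk.comp (by fun_prop)).memLp_of_hasCompactSupport
    (hc.comp_homeomorph (Homeomorph.subLeft x))

/-- The translate `y ↦ k (x - y)` of a kernel as an element of `L²(Ω)`. -/
noncomputable def translateL2 (Ω : Set (Pt d)) {k : Pt d → ℝ} (hk : Continuous k) (hc : HasCompactSupport k)
    (x : Pt d) : L2 Ω :=
  (memLp_translate hk hc x).toLp

/-- This form exhibits compactness: finitely many translates of the kernel nearly determine the
convolution at every point of a bounded set. -/
theorem conv_eq_inner {k : Pt d → ℝ} (hk : Continuous k) (hc : HasCompactSupport k) (f : L2 Ω) (x : Pt d) :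
    conv (volume.restrict Ω) f k x = inner ℝ (translateL2 Ω hk hc x) f := by
  rw [L2.inner_def, conv]
  refine integral_congr_ae ?_
  filter_upwards [(memLp_translate (Ω := Ω) hk hc x).coeFn_toLp] with y hy
  change _ = inner ℝ ((translateL2 Ω hk hc x) y) (f y)
  rw [translateL2, hy]
  rfl

variable [IsFiniteMeasure (volume.restrict Ω)]

theorem L2.integrable (f : L2 Ω) : Integrable f (volume.restrict Ω) :=
  (Lp.memLp f).integrable (by norm_num)

/-- Convolution with a continuous compactly supported kernel, as an operator on `L²(Ω)`. -/
noncomputable def convL (Ω : Set (Pt d)) [IsFiniteMeasure (volume.restrict Ω)] {k : Pt d → ℝ}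
    (hk : Continuous k) (hc : HasCompactSupport k) : L2 Ω →L[ℝ] L2 Ω :=
  LinearMap.mkContinuous
    { toFun := fun f => (memLp_conv f hk hc f.integrable).toLp _
      map_add' := fun f g => by
        rw [← MemLp.toLp_add]
        refine MemLp.toLp_congr _ _ (.of_forall fun x => ?_)
        rw [Pi.add_apply, conv, conv, conv, ← integral_add (integrable_mul_kernel f.integrable hk hc x)
          (integrable_mul_kernel g.integrable hk hc x)]
        refine integral_congr_ae ?_
        filter_upwards [Lp.coeFn_add f g] with y hy
        rw [hy, Pi.add_apply, add_mul]
      map_smul' := fun a f => by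
        rw [RingHom.id_apply, ← MemLp.toLp_const_smul]
        refine MemLp.toLp_congr _ _ (.of_forall fun x => ?_)
        rw [Pi.smul_apply, conv, conv, smul_eq_mul, ← integral_const_mul]
        refine integral_congr_ae ?_
        filter_upwards [Lp.coeFn_smul a f] with y hy
        rw [hy, Pi.smul_apply, smul_eq_mul, mul_assoc] }
    (∫ x, ‖k x‖) fun f => by
      have h0 : 0 ≤ ∫ x, ‖k x‖ := integral_nonneg fun _ => norm_nonneg _
      have h := eLpNorm_conv_le (Measure.restrict_le_self (s := Ω))
        (Lp.aestronglyMeasurable f).aemeasurable hk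
      rw [lintegral_enorm_eq_ofReal hk hc] at h
      refine (Lp.norm_toLp _ (memLp_conv f hk hc f.integrable)).trans_le ?_
      refine ENNReal.toReal_le_of_le_ofReal (by positivity) ?_
      rw [ENNReal.ofReal_mul h0, Lp.norm_def, ENNReal.ofReal_toReal (Lp.eLpNorm_ne_top f)]
      exact (eLpNorm_mono_measure _ Measure.restrict_le_self).trans h

variable {k : Pt d → ℝ} (hk : Continuous k) (hc : HasCompactSupport k)

theorem coeFn_convL (f : L2 Ω) :
    convL Ω hk hc f =ᵐ[volume.restrict Ω] conv (volume.restrict Ω) f k :=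
  MemLp.coeFn_toLp (memLp_conv f hk hc f.integrable)

theorem norm_convL_le : ‖convL Ω hk hc‖ ≤ ∫ x, ‖k x‖ :=
  LinearMap.mkContinuous_norm_le _ (integral_nonneg fun _ => norm_nonneg _) _

theorem continuous_translateL2 : Continuous (translateL2 Ω hk hc) := by
  have hu : UniformContinuous k := hk.uniformContinuous_of_tendsto_cocompact
    hc.is_zero_at_infty
  -- `m` is the square root of the measure of `Ω`, the factor from a uniform bound to an `L²` bound;
  -- `m + 1` avoids division by zero.
  set m : ℝ := (measureUnivNNReal (volume.restrict Ω) : ℝ) ^ (2 : ENNReal).toReal⁻¹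
  have hm : 0 ≤ m := by positivity
  rw [Metric.continuous_iff]
  intro x ε hε
  obtain ⟨δ, hδ, h⟩ := Metric.uniformContinuous_iff.1 hu (ε / (m + 1)) (by positivity)
  refine ⟨δ, hδ, fun z hz => ?_⟩
  rw [dist_eq_norm, translateL2, translateL2, ← MemLp.toLp_sub]
  refine (Lp.norm_le_of_ae_bound (C := ε / (m + 1)) (by positivity) ?_).trans_lt ?_
  · filter_upwards [((memLp_translate (Ω := Ω) hk hc z).sub
      (memLp_translate hk hc x)).coeFn_toLp] with y hy
    rw [hy, Pi.sub_apply, ← dist_eq_norm]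
    refine (h ?_).le
    rwa [dist_sub_right]
  · change m * (ε / (m + 1)) < ε
    rw [mul_div_assoc', div_lt_iff₀ (by positivity)]
    nlinarith

/-- Convolution operators on bounded sets are compact. -/
theorem isCompactOperator_convL (hΩ : Bornology.IsBounded Ω) (hΩm : MeasurableSet Ω) :
    IsCompactOperator (convL Ω hk hc) := by
  set m : ℝ := (measureUnivNNReal (volume.restrict Ω) : ℝ) ^ (2 : ENNReal).toReal⁻¹
  have hm : 0 ≤ m := by positivity
  refine isCompactOperator_of_forall_exists fun ε hε => ?_
  have htot : TotallyBounded (translateL2 Ω hk hc '' closure Ω) :=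
    (hΩ.isCompact_closure.image (continuous_translateL2 hk hc)).totallyBounded
  obtain ⟨s, hs, hcov⟩ := Metric.totallyBounded_iff.1 htot (ε / (m + 1)) (by positivity)
  -- `s` is a finite net for the translates of the kernel over `closure Ω`. Composing the
  -- convolution with the projection to `V` has finite rank. The error at `x` pairs the translate at
  -- `x` with `f` minus its projection, and since this is orthogonal to `V`, a nearby element of the
  -- net may be subtracted from the translate.
  let V := Submodule.span ℝ s
  have : FiniteDimensional ℝ V := FiniteDimensional.span_of_finite ℝ hs
  refine ⟨(convL Ω hk hc ∘L V.subtypeL) ∘L V.orthogonalProjectionOnto, ?_, ?_⟩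
  · exact (isCompactOperator_of_locallyCompactSpace_rng (convL Ω hk hc ∘L V.subtypeL)).comp_clm _
  intro f
  have hε' : m * (ε / (m + 1)) ≤ ε := by
    rw [mul_div_assoc', div_le_iff₀ (by positivity)]
    nlinarith
  refine le_trans ?_ (mul_le_mul_of_nonneg_right hε' (norm_nonneg f))
  rw [mul_assoc]
  refine Lp.norm_le_of_ae_bound (by positivity) ?_
  change ∀ᵐ x ∂(volume.restrict Ω), ‖(convL Ω hk hc f - convL Ω hk hc
    (V.starProjection f) : L2 Ω) x‖ ≤ _
  filter_upwards [Lp.coeFn_sub (convL Ω hk hc f) (convL Ω hk hc (V.starProjection f)),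
    coeFn_convL hk hc f, coeFn_convL hk hc (V.starProjection f),
    ae_restrict_mem hΩm] with x h1 h2 h3 hx
  rw [h1, Pi.sub_apply, h2, h3, conv_eq_inner hk hc, conv_eq_inner hk hc, ← inner_sub_right]
  obtain ⟨w, hw, hdist⟩ := Set.mem_iUnion₂.1 (hcov ⟨x, subset_closure hx, rfl⟩)
  have hwV : inner ℝ w (f - V.starProjection f) = 0 :=
    V.sub_starProjection_mem_orthogonal f w (Submodule.subset_span hw)
  have h4 : inner ℝ (translateL2 Ω hk hc x) (f - V.starProjection f) =
      inner ℝ (translateL2 Ω hk hc x - w) (f - V.starProjection f) := by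
    rw [inner_sub_left, hwV, sub_zero]
  have h5 : ‖f - V.starProjection f‖ ≤ ‖f‖ := by
    rw [← Submodule.starProjection_orthogonal_val]
    exact Vᗮ.norm_starProjection_apply_le f
  rw [h4]
  refine (norm_inner_le_norm _ _).trans ?_
  gcongr
  rw [← dist_eq_norm]
  exact (Metric.mem_ball.1 hdist).le

end ConvolutionOperator

/-! ### Test functions and duality in `L²(Ω)` -/

section TestFunctions

variable {d : ℕ} {Ω : Set (Pt d)} {ζ ξ χ : Pt d → ℝ}

theorem IsTest.zero : IsTest Ω (0 : Pt d → ℝ) :=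
  ⟨contDiff_const, HasCompactSupport.zero, by simp [tsupport]⟩

theorem IsTest.add (hζ : IsTest Ω ζ) (hξ : IsTest Ω ξ) : IsTest Ω (ζ + ξ) :=
  ⟨hζ.contDiff.add hξ.contDiff, hζ.hasCompactSupport.add hξ.hasCompactSupport,
    (tsupport_add ζ ξ).trans (Set.union_subset hζ.tsupport_subset hξ.tsupport_subset)⟩

theorem IsTest.smul (c : ℝ) (hζ : IsTest Ω ζ) : IsTest Ω (c • ζ) :=
  ⟨contDiff_const.smul hζ.contDiff, hζ.hasCompactSupport.smul_left (f := fun _ => c),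
    (tsupport_smul_subset_right (fun _ => c) ζ).trans hζ.tsupport_subset⟩

theorem IsTest.eq_zero (hζ : IsTest Ω ζ) {x : Pt d} (hx : x ∉ Ω) : ζ x = 0 :=
  image_eq_zero_of_notMem_tsupport fun h => hx (hζ.tsupport_subset h)

theorem IsTest.setIntegral_mul (hζ : IsTest Ω ζ) (g : Pt d → ℝ) :
    ∫ x in Ω, g x * ζ x = ∫ x, g x * ζ x :=
  setIntegral_eq_integral_of_forall_compl_eq_zero fun x hx => by rw [hζ.eq_zero hx, mul_zero]

theorem IsTest.memLp_volume (hζ : IsTest Ω ζ) : MemLp ζ 2 volume :=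
  hζ.contDiff.continuous.memLp_of_hasCompactSupport hζ.hasCompactSupport

theorem IsTest.memLp (hζ : IsTest Ω ζ) : MemLp ζ 2 (volume.restrict Ω) :=
  hζ.memLp_volume.restrict Ω

/-- A test function as an element of `L²(Ω)`. -/
noncomputable def IsTest.toL2 (hζ : IsTest Ω ζ) : L2 Ω := hζ.memLp.toLp ζ

theorem IsTest.coeFn_toL2 (hζ : IsTest Ω ζ) : hζ.toL2 =ᵐ[volume.restrict Ω] ζ :=
  hζ.memLp.coeFn_toLp

theorem IsTest.norm_toL2 (hζ : IsTest Ω ζ) : ‖hζ.toL2‖ = (eLpNorm ζ 2 volume).toReal := by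
  rw [IsTest.toL2, Lp.norm_toLp, eLpNorm_restrict_eq_of_support_subset]
  intro x hx
  by_contra h
  exact hx (hζ.eq_zero h)

theorem IsTest.inner_toL2 (hζ : IsTest Ω ζ) (g : L2 Ω) :
    inner ℝ g hζ.toL2 = ∫ x in Ω, g x * ζ x := by
  rw [L2.inner_def]
  refine integral_congr_ae ?_
  filter_upwards [hζ.coeFn_toL2] with x hx
  rw [hx]
  exact mul_comm _ _

/-- The subspace of `L²(Ω)` of test functions. -/
def testSubmodule (Ω : Set (Pt d)) : Submodule ℝ (L2 Ω) where
  carrier := {f | ∃ ζ, ∃ hζ : IsTest Ω ζ, hζ.toL2 = f}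
  zero_mem' := ⟨0, IsTest.zero, MemLp.toLp_zero _⟩
  add_mem' := by
    rintro _ _ ⟨ζ, hζ, rfl⟩ ⟨ξ, hξ, rfl⟩
    exact ⟨ζ + ξ, hζ.add hξ, MemLp.toLp_add _ _⟩
  smul_mem' := by
    rintro c _ ⟨ζ, hζ, rfl⟩
    exact ⟨c • ζ, hζ.smul c, MemLp.toLp_const_smul _ _⟩

variable [IsFiniteMeasure (volume.restrict Ω)]

theorem L2.eq_zero_of_forall_test (hΩ : IsOpen Ω) {g : L2 Ω}
    (h : ∀ ζ, IsTest Ω ζ → ∫ x in Ω, g x * ζ x = 0) : g = 0 := by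
  have h1 : LocallyIntegrableOn g Ω volume :=
    IntegrableOn.locallyIntegrableOn (show IntegrableOn g Ω volume from g.integrable)
  have h2 := hΩ.ae_eq_zero_of_integral_contDiff_smul_eq_zero h1 fun ζ h3 h4 h5 => by
    have hζ : IsTest Ω ζ := ⟨h3, h4, h5⟩
    rw [← h ζ hζ, hζ.setIntegral_mul]
    simp_rw [smul_eq_mul, mul_comm]
  rw [Lp.eq_zero_iff_ae_eq_zero]
  exact (ae_restrict_iff' hΩ.measurableSet).2 h2

theorem dense_testSubmodule (hΩ : IsOpen Ω) : Dense (testSubmodule Ω : Set (L2 Ω)) := by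
  rw [← Submodule.dense_iff_topologicalClosure_eq_top.symm]
  rw [Submodule.topologicalClosure_eq_top_iff, Submodule.eq_bot_iff]
  intro g hg
  refine L2.eq_zero_of_forall_test hΩ fun ζ hζ => ?_
  rw [← hζ.inner_toL2, real_inner_comm]
  exact hg _ ⟨ζ, hζ, rfl⟩

/-- By density the bound holds for every `u` in `L²(Ω)`, and `u = g` gives the claim. Smoothing
errors can thus be estimated with the translation moved onto a smooth function. -/
theorem L2.norm_le_of_forall_test (hΩ : IsOpen Ω) {g : L2 Ω} {M : ℝ} (hM : 0 ≤ M)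
    (h : ∀ ζ, ∀ hζ : IsTest Ω ζ, |∫ x in Ω, g x * ζ x| ≤ M * ‖hζ.toL2‖) : ‖g‖ ≤ M := by
  have hcl : IsClosed {u : L2 Ω | |inner ℝ g u| ≤ M * ‖u‖} :=
    isClosed_le (by fun_prop) (by fun_prop)
  have hall : ∀ u : L2 Ω, |inner ℝ g u| ≤ M * ‖u‖ := by
    intro u
    refine hcl.closure_subset_iff.2 ?_ (dense_testSubmodule hΩ u)
    rintro _ ⟨ζ, hζ, rfl⟩
    change |inner ℝ g hζ.toL2| ≤ _
    rw [hζ.inner_toL2]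
    exact h ζ hζ
  have hg := hall g
  rw [real_inner_self_eq_norm_sq, abs_of_nonneg (by positivity)] at hg
  by_contra! hlt
  nlinarith [hM.trans_lt hlt]

end TestFunctions

/-! ### Difference quotients and averages of translates, in weak form -/

section WeakGradient

variable {d : ℕ} {Ω : Set (Pt d)} {ζ χ : Pt d → ℝ}

/-- The functions `g i` are the weak partial derivatives of `f` in `Ω`. -/
def IsWeakGrad (f : L2 Ω) (g : Fin d → L2 Ω) : Prop :=
  ∀ ζ : Pt d → ℝ, IsTest Ω ζ → ∀ i, ∫ x in Ω, f x * pderiv i ζ x = -∫ x in Ω, g i x * ζ x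

theorem fderiv_apply_eq_sum_pderiv (φ : Pt d → ℝ) (x v : Pt d) :
    fderiv ℝ φ x v = ∑ i, v i * pderiv i φ x := by
  conv_lhs => rw [← (EuclideanSpace.basisFun (Fin d) ℝ).sum_repr v]
  rw [map_sum]
  refine Finset.sum_congr rfl fun i _ => ?_
  rw [map_smul, smul_eq_mul, EuclideanSpace.basisFun_repr, EuclideanSpace.basisFun_apply]
  rfl

theorem integrable_mul_of_memLp (f : L2 Ω) {u : Pt d → ℝ} (hu : MemLp u 2 (volume.restrict Ω)) :
    Integrable (fun x => f x * u x) (volume.restrict Ω) :=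
  MemLp.integrable_mul (p := 2) (q := 2) (Lp.memLp f) hu

theorem abs_integral_mul_le (f : L2 Ω) {u : Pt d → ℝ} (hu : MemLp u 2 (volume.restrict Ω)) :
    |∫ x in Ω, f x * u x| ≤ ‖f‖ * (eLpNorm u 2 (volume.restrict Ω)).toReal := by
  have h : ∫ x in Ω, f x * u x = inner ℝ f (hu.toLp u) := by
    rw [L2.inner_def]
    refine integral_congr_ae ?_
    filter_upwards [hu.coeFn_toLp] with x hx
    rw [hx]
    exact mul_comm _ _
  rw [h, ← Lp.norm_toLp u hu]
  exact abs_real_inner_le_norm _ _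

/-- A point of the support of the product is `y + w` with `y ∈ Ω`, and lies in the support of `χ`;
the hypothesis then keeps it in `Ω`. -/
theorem IsTest.mul_translate (hζ : IsTest Ω ζ) (hχ : ContDiff ℝ ∞ χ) (w : Pt d)
    (h : ∀ y ∈ Ω, y + w ∈ tsupport χ → y + w ∈ Ω) : IsTest Ω (fun y => χ y * ζ (y - w)) := by
  have hs : tsupport (fun y => ζ (y - w)) = (fun y => y - w) ⁻¹' tsupport ζ :=
    tsupport_comp_eq_preimage ζ (Homeomorph.subRight w)
  refine ⟨hχ.mul (hζ.contDiff.comp (contDiff_id.sub contDiff_const)), ?_, ?_⟩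
  · exact (hζ.hasCompactSupport.comp_homeomorph (Homeomorph.subRight w)).mul_left
  · intro y hy
    have h1 : y ∈ tsupport χ := tsupport_mul_subset_left hy
    have h2 : y ∈ tsupport fun y => ζ (y - w) := tsupport_mul_subset_right hy
    rw [hs] at h2
    have := h (y - w) (hζ.tsupport_subset h2)
    rw [sub_add_cancel] at this
    exact this h1

theorem IsTest.memLp_mul_translate (hζ : IsTest Ω ζ) {m : Pt d → ℝ} (hm : Continuous m)
    {C : ℝ} (hC : ∀ x, |m x| ≤ C) (w : Pt d) :
    MemLp (fun y => m y * ζ (y - w)) 2 (volume.restrict Ω) ∧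
      (eLpNorm (fun y => m y * ζ (y - w)) 2 (volume.restrict Ω)).toReal ≤ C * ‖hζ.toL2‖ := by
  have hC0 : 0 ≤ C := (abs_nonneg _).trans (hC 0)
  have hmp := measurePreserving_sub_right (volume : Measure (Pt d)) w
  have h1 : MemLp (fun y => ζ (y - w)) 2 (volume : Measure (Pt d)) :=
    hζ.memLp_volume.comp_measurePreserving hmp
  have h2 : eLpNorm (fun y => ζ (y - w)) 2 volume = eLpNorm ζ 2 volume :=
    eLpNorm_comp_measurePreserving hζ.memLp_volume.aestronglyMeasurable hmp
  have h3 : eLpNorm (fun y => m y * ζ (y - w)) 2 (volume.restrict Ω) ≤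
      ENNReal.ofReal C * eLpNorm ζ 2 volume := by
    rw [← h2]
    refine (eLpNorm_mono_measure _ Measure.restrict_le_self).trans ?_
    refine eLpNorm_le_mul_eLpNorm_of_ae_le_mul (.of_forall fun y => ?_) 2
    rw [norm_mul, Real.norm_eq_abs]
    gcongr
    exact hC y
  have htop : ENNReal.ofReal C * eLpNorm ζ 2 volume < ⊤ :=
    ENNReal.mul_lt_top ENNReal.ofReal_lt_top hζ.memLp_volume.2
  refine ⟨⟨(hm.mul (hζ.contDiff.continuous.comp (by fun_prop))).aestronglyMeasurable,
    h3.trans_lt htop⟩, ?_⟩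
  calc _ ≤ (ENNReal.ofReal C * eLpNorm ζ 2 volume).toReal := ENNReal.toReal_mono htop.ne h3
    _ = _ := by rw [ENNReal.toReal_mul, ENNReal.toReal_ofReal hC0, hζ.norm_toL2]

/-- The derivative along `z` of a translated test function, cut off by `χ`, paired with a function
which has a weak gradient. -/
theorem IsWeakGrad.abs_integral_mul_fderiv_translate_le {f : L2 Ω} {g : Fin d → L2 Ω}
    (h : IsWeakGrad f g) (hζ : IsTest Ω ζ) (hχ : ContDiff ℝ ∞ χ) {C : ℝ} (hC : ∀ x, |χ x| ≤ C)
    (hC' : ∀ x, ‖fderiv ℝ χ x‖ ≤ C) (z w : Pt d)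
    (hw : ∀ y ∈ Ω, y + w ∈ tsupport χ → y + w ∈ Ω) :
    |∫ y in Ω, f y * (χ y * fderiv ℝ ζ (y - w) z)| ≤
      ‖z‖ * (C * (‖f‖ + ∑ i, ‖g i‖)) * ‖hζ.toL2‖ := by
  have hC0 : 0 ≤ C := (abs_nonneg _).trans (hC 0)
  have hζw := hζ.mul_translate hχ w hw
  have hχc : Continuous (fun y => fderiv ℝ χ y z) :=
    (hχ.continuous_fderiv (by simp)).clm_apply continuous_const
  have hbz : ∀ y, |fderiv ℝ χ y z| ≤ ‖z‖ * C := fun y => by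
    rw [mul_comm]
    exact ((fderiv ℝ χ y).le_opNorm z).trans (by gcongr; exact hC' y)
  obtain ⟨hm1, hn1⟩ := hζ.memLp_mul_translate hχ.continuous hC w
  obtain ⟨hm2, hn2⟩ := hζ.memLp_mul_translate hχc hbz w
  have hint : ∀ i, Integrable (fun y => f y * pderiv i (fun y => χ y * ζ (y - w)) y)
      (volume.restrict Ω) := fun i => integrable_mul_of_memLp f
    ((hζw.continuous_pderiv i).memLp_of_hasCompactSupport (hζw.hasCompactSupport_pderiv i))
  -- Product rule: the term with `χ * ∂ζ` is the derivative of the test function `χ * ζ (· - w)`, to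
  -- which the weak gradient applies, minus a term with the derivative on `χ`.
  have hpt : ∀ y, f y * (χ y * fderiv ℝ ζ (y - w) z) =
      (∑ i, z i * (f y * pderiv i (fun y => χ y * ζ (y - w)) y)) -
        f y * (fderiv ℝ χ y z * ζ (y - w)) := by
    intro y
    have h1 : HasFDerivAt ζ (fderiv ℝ ζ (y - w)) (y - w) :=
      (hζ.contDiff.differentiable (by simp) _).hasFDerivAt
    have h2 : HasFDerivAt (fun y => ζ (y - w)) (fderiv ℝ ζ (y - w)) y :=
      (h1.comp y ((hasFDerivAt_id y).sub_const w) :)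
    have h3 : HasFDerivAt χ (fderiv ℝ χ y) y := (hχ.differentiable (by simp) _).hasFDerivAt
    have h4 := (h3.mul h2).fderiv
    have h5 := fderiv_apply_eq_sum_pderiv (fun y => χ y * ζ (y - w)) y z
    have h6 : fderiv ℝ (fun y => χ y * ζ (y - w)) y z =
        χ y * fderiv ℝ ζ (y - w) z + ζ (y - w) * fderiv ℝ χ y z := by
      have : (fun y => χ y * ζ (y - w)) = χ * fun y => ζ (y - w) := rfl
      rw [this, h4]
      rfl
    simp_rw [mul_left_comm _ (f y)]
    rw [← Finset.mul_sum, ← h5, h6]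
    ring
  have heq : ∫ y in Ω, f y * (χ y * fderiv ℝ ζ (y - w) z) =
      (∑ i, z i * -∫ y in Ω, g i y * (χ y * ζ (y - w))) -
        ∫ y in Ω, f y * (fderiv ℝ χ y z * ζ (y - w)) := by
    simp_rw [hpt]
    rw [integral_sub (integrable_finsetSum _ fun i _ => (hint i).const_mul _)
      (integrable_mul_of_memLp f hm2), integral_finsetSum _ fun i _ => (hint i).const_mul _]
    congr 1
    refine Finset.sum_congr rfl fun i _ => ?_
    rw [integral_const_mul, h _ hζw i]
  rw [heq]
  have hzi : ∀ i, |z i| ≤ ‖z‖ := fun i => by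
    simpa using PiLp.norm_apply_le z i
  calc _ ≤ |∑ i, z i * -∫ y in Ω, g i y * (χ y * ζ (y - w))| +
        |∫ y in Ω, f y * (fderiv ℝ χ y z * ζ (y - w))| := abs_sub _ _
    _ ≤ (∑ i, ‖z‖ * (‖g i‖ * (C * ‖hζ.toL2‖))) + ‖f‖ * (‖z‖ * C * ‖hζ.toL2‖) := by
        gcongr
        · refine (Finset.abs_sum_le_sum_abs _ _).trans (Finset.sum_le_sum fun i _ => ?_)
          rw [abs_mul, abs_neg]
          gcongr
          · exact hzi i
          · exact (abs_integral_mul_le _ hm1).trans (by gcongr)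
        · exact (abs_integral_mul_le _ hm2).trans (by gcongr)
    _ = _ := by
        rw [← Finset.mul_sum, ← Finset.sum_mul]
        ring

theorem hasDerivAt_integral_translate {f : Pt d → ℝ} (hf : Integrable f (volume.restrict Ω))
    (hχ : Continuous χ) {C : ℝ} (hC : ∀ x, |χ x| ≤ C) (hζ : IsTest Ω ζ) (z : Pt d) (s : ℝ) :
    HasDerivAt (fun s : ℝ => ∫ y in Ω, f y * (χ y * ζ (y - s • z)))
      (∫ y in Ω, f y * (χ y * -fderiv ℝ ζ (y - s • z) z)) s := by
  have hC0 : 0 ≤ C := (abs_nonneg _).trans (hC 0)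
  have hζ' : Continuous (fderiv ℝ ζ) := hζ.contDiff.continuous_fderiv (by simp)
  have hζc := hζ.contDiff.continuous
  obtain ⟨D, hD0, hD⟩ := exists_bound_of_continuous hζ' (hζ.hasCompactSupport.fderiv (𝕜 := ℝ))
  obtain ⟨D', hD0', hD'⟩ := exists_bound_of_continuous hζc hζ.hasCompactSupport
  refine (hasDerivAt_integral_of_dominated_loc_of_deriv_le (μ := volume.restrict Ω)
    (s := Set.univ) (bound := fun y => ‖f y‖ * (C * (D * ‖z‖)))
    (F := fun s y => f y * (χ y * ζ (y - s • z)))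
    (F' := fun s y => f y * (χ y * -fderiv ℝ ζ (y - s • z) z)) univ_mem (.of_forall fun s => ?_)
    ?_ ?_ (.of_forall fun y s _ => ?_) (hf.norm.mul_const _) (.of_forall fun y s _ => ?_)).2
  · exact hf.aestronglyMeasurable.mul (by fun_prop : Continuous _).aestronglyMeasurable
  · refine hf.mul_bdd (c := C * D') (by fun_prop : Continuous _).aestronglyMeasurable
      (.of_forall fun y => ?_)
    rw [norm_mul]
    have := hC y
    have := hD' (y - s • z)
    gcongr
    exact hC y
  · exact hf.aestronglyMeasurable.mul (by fun_prop : Continuous _).aestronglyMeasurable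
  · rw [norm_mul, norm_mul, norm_neg]
    gcongr
    · exact hC y
    · exact (ContinuousLinearMap.le_opNorm _ _).trans (by gcongr; exact hD _)
  · have h1 : HasFDerivAt ζ (fderiv ℝ ζ (y - s • z)) (y - s • z) :=
      (hζ.contDiff.differentiable (by simp) _).hasFDerivAt
    have h2 : HasDerivAt (fun s : ℝ => y - s • z) (-z) s := by
      simpa using ((hasDerivAt_id s).smul_const z).const_sub y
    have h3 := h1.comp_hasDerivAt s h2
    rw [map_neg] at h3
    exact (h3.const_mul (χ y)).const_mul (f y)

/-- The difference quotient estimate, in weak form: the pairing of `χ * f` with a test function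
changes by `O(‖z‖)` when the test function is translated by `z`, provided that the translations do
not leave `Ω` on the support of `χ`. -/
theorem IsWeakGrad.abs_integral_translate_sub_le [IsFiniteMeasure (volume.restrict Ω)] {f : L2 Ω} {g : Fin d → L2 Ω}
    (h : IsWeakGrad f g) (hζ : IsTest Ω ζ) (hχ : ContDiff ℝ ∞ χ) {C : ℝ} (hC : ∀ x, |χ x| ≤ C)
    (hC' : ∀ x, ‖fderiv ℝ χ x‖ ≤ C) (z : Pt d)
    (hw : ∀ s : ℝ, 0 ≤ s → s ≤ 1 → ∀ y ∈ Ω, y + s • z ∈ tsupport χ → y + s • z ∈ Ω) :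
    |(∫ y in Ω, f y * (χ y * ζ (y - z))) - ∫ y in Ω, f y * (χ y * ζ y)| ≤
      ‖z‖ * (C * (‖f‖ + ∑ i, ‖g i‖)) * ‖hζ.toL2‖ := by
  -- Mean value inequality along the segment of translations `s • z`; every intermediate translate
  -- must be admissible, hence the condition for all `s` in `[0, 1]`.
  have key := norm_image_sub_le_of_norm_deriv_le_segment_01'
    (f := fun s : ℝ => ∫ y in Ω, f y * (χ y * ζ (y - s • z)))
    (C := ‖z‖ * (C * (‖f‖ + ∑ i, ‖g i‖)) * ‖hζ.toL2‖)
    (fun s _ => (hasDerivAt_integral_translate f.integrable hχ.continuous hC hζ z s).hasDerivWithinAt)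
    (fun s hs => by
      have := h.abs_integral_mul_fderiv_translate_le hζ hχ hC hC' z (s • z) (hw s hs.1 hs.2.le)
      simp_rw [mul_neg, integral_neg, norm_neg]
      exact this)
  simpa using key

/-- A convolution paired with a test function is an average of pairings with translates. -/
theorem integral_conv_mul {h k : Pt d → ℝ} (hh : Integrable h (volume.restrict Ω))
    (hk : Continuous k) (hc : HasCompactSupport k) (hζ : IsTest Ω ζ) :
    ∫ x in Ω, conv (volume.restrict Ω) h k x * ζ x =
      ∫ z, k z * ∫ y in Ω, h y * ζ (y + z) := by
  have hζc := hζ.contDiff.continuous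
  obtain ⟨C, _, hC⟩ := exists_bound_of_continuous hk hc
  obtain ⟨D, _, hD⟩ := exists_bound_of_continuous hζc hζ.hasCompactSupport
  have hζi : Integrable ζ volume := hζc.integrable_of_hasCompactSupport hζ.hasCompactSupport
  have hki : Integrable k volume := hk.integrable_of_hasCompactSupport hc
  have hi1 : Integrable (Function.uncurry fun x y => h y * k (x - y) * ζ x)
      (volume.prod (volume.restrict Ω)) := by
    have h1 : Integrable (fun p : Pt d × Pt d => ζ p.1 * h p.2) (volume.prod (volume.restrict Ω)) :=
      hζi.mul_prod hh
    refine (h1.mul_bdd (c := C) (g := fun p => k (p.1 - p.2))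
      (by fun_prop : Continuous _).aestronglyMeasurable (.of_forall fun p => hC _)).congr
      (.of_forall fun p => ?_)
    simp only [Function.uncurry]
    ring
  have hi2 : Integrable (Function.uncurry fun y z => k z * (h y * ζ (y + z)))
      ((volume.restrict Ω).prod volume) := by
    have h1 : Integrable (fun p : Pt d × Pt d => h p.1 * k p.2) ((volume.restrict Ω).prod volume) :=
      hh.mul_prod hki
    refine (h1.mul_bdd (c := D) (g := fun p => ζ (p.1 + p.2))
      (by fun_prop : Continuous _).aestronglyMeasurable (.of_forall fun p => hD _)).congr
      (.of_forall fun p => ?_)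
    simp only [Function.uncurry]
    ring
  rw [hζ.setIntegral_mul]
  simp_rw [conv, ← integral_mul_const]
  rw [integral_integral_swap hi1]
  simp_rw [← integral_const_mul]
  rw [← integral_integral_swap hi2]
  refine integral_congr_ae (.of_forall fun y => ?_)
  simp only
  -- Substitution `x = z + y` in the integral over the whole space.
  rw [← integral_add_right_eq_self _ y]
  refine integral_congr_ae (.of_forall fun z => ?_)
  simp only [add_sub_cancel_right, add_comm y z]
  ring

/-- Averaging translates over a probability density. -/
theorem abs_integral_conv_mul_sub_le {h k : Pt d → ℝ} (hh : Integrable h (volume.restrict Ω))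
    (hk : Continuous k) (hc : HasCompactSupport k) (hk0 : ∀ z, 0 ≤ k z) (hk1 : ∫ z, k z = 1)
    (hζ : IsTest Ω ζ) {B : ℝ}
    (hB : ∀ z, k z ≠ 0 → |(∫ y in Ω, h y * ζ (y + z)) - ∫ y in Ω, h y * ζ y| ≤ B) :
    |(∫ x in Ω, conv (volume.restrict Ω) h k x * ζ x) - ∫ y in Ω, h y * ζ y| ≤ B := by
  have hki : Integrable k volume := hk.integrable_of_hasCompactSupport hc
  have hζc := hζ.contDiff.continuous
  obtain ⟨D, _, hD⟩ := exists_bound_of_continuous hζc hζ.hasCompactSupport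
  have hcont : Continuous fun z => ∫ y in Ω, h y * ζ (y + z) := by
    refine continuous_of_dominated (bound := fun y => ‖h y‖ * D) (fun x => ?_) (fun x => ?_)
      (hh.norm.mul_const _) (.of_forall fun y => by fun_prop)
    · exact hh.aestronglyMeasurable.mul (by fun_prop : Continuous _).aestronglyMeasurable
    · refine .of_forall fun y => ?_
      rw [norm_mul]
      gcongr
      exact hD _
  have hi : Integrable (fun z => k z * ∫ y in Ω, h y * ζ (y + z)) volume :=
    (hk.mul hcont).integrable_of_hasCompactSupport hc.mul_right
  have heq : (∫ x in Ω, conv (volume.restrict Ω) h k x * ζ x) - ∫ y in Ω, h y * ζ y =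
      ∫ z, k z * ((∫ y in Ω, h y * ζ (y + z)) - ∫ y in Ω, h y * ζ y) := by
    simp_rw [mul_sub]
    rw [integral_sub hi (hki.mul_const _), integral_mul_const, hk1, one_mul,
      integral_conv_mul hh hk hc hζ]
  rw [heq]
  have hle := norm_integral_le_of_norm_le (hki.mul_const B)
    (f := fun z => k z * ((∫ y in Ω, h y * ζ (y + z)) - ∫ y in Ω, h y * ζ y))
    (.of_forall fun z => by
      by_cases hz : k z = 0
      · simp [hz]
      rw [norm_mul, Real.norm_eq_abs, Real.norm_eq_abs, abs_of_nonneg (hk0 z)]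
      exact mul_le_mul_of_nonneg_left (hB z hz) (hk0 z))
  rwa [integral_mul_const, hk1, one_mul] at hle

end WeakGradient

/-! ### Mollifiers and their translates -/

section Mollifier

variable {d : ℕ}

/-- A smooth probability density supported in the closed ball of radius `δ` around `a`. -/
structure IsMollifier (ρ : Pt d → ℝ) (a : Pt d) (δ : ℝ) : Prop where
  contDiff : ContDiff ℝ ∞ ρ
  tsupport_subset : tsupport ρ ⊆ Metric.closedBall a δ
  nonneg : ∀ z, 0 ≤ ρ z
  integral_eq_one : ∫ z, ρ z = 1

theorem exists_isMollifier {δ : ℝ} (hδ : 0 < δ) : ∃ ρ : Pt d → ℝ, IsMollifier ρ 0 δ := by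
  let b : ContDiffBump (0 : Pt d) := ⟨δ / 2, δ, half_pos hδ, half_lt_self hδ⟩
  exact ⟨b.normed volume, b.contDiff_normed, b.tsupport_normed_eq.subset, b.nonneg_normed,
    b.integral_normed⟩

variable {ρ : Pt d → ℝ} {a : Pt d} {δ : ℝ}

theorem IsMollifier.continuous (h : IsMollifier ρ a δ) : Continuous ρ := h.contDiff.continuous

theorem IsMollifier.hasCompactSupport (h : IsMollifier ρ a δ) : HasCompactSupport ρ :=
  (isCompact_closedBall a δ).of_isClosed_subset (isClosed_tsupport _) h.tsupport_subset

theorem IsMollifier.norm_sub_le (h : IsMollifier ρ a δ) {z : Pt d} (hz : ρ z ≠ 0) :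
    ‖z - a‖ ≤ δ := by
  rw [← dist_eq_norm]
  exact h.tsupport_subset (subset_tsupport _ hz)

theorem IsMollifier.integral_norm (h : IsMollifier ρ a δ) : ∫ z, ‖ρ z‖ = 1 := by
  rw [← h.integral_eq_one]
  refine integral_congr_ae (.of_forall fun z => ?_)
  exact abs_of_nonneg (h.nonneg z)

/-- For a mollifier centred at `0`, convolution with this kernel samples a function near `x + w`, so
a shift of the centre to `-w` realizes a translation of the sampled points by `w`. -/
theorem IsMollifier.translate (h : IsMollifier ρ a δ) (w : Pt d) :
    IsMollifier (fun z => ρ (z + w)) (a - w) δ where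
  contDiff := h.contDiff.comp (contDiff_id.add contDiff_const)
  tsupport_subset := by
    have hs : tsupport (fun z => ρ (z + w)) = (fun z => z + w) ⁻¹' tsupport ρ :=
      tsupport_comp_eq_preimage ρ (Homeomorph.addRight w)
    rw [hs]
    intro z hz
    have := h.tsupport_subset hz
    rw [Metric.mem_closedBall, dist_eq_norm] at this ⊢
    rwa [sub_sub_eq_add_sub]
  nonneg z := h.nonneg _
  integral_eq_one := by rw [integral_add_right_eq_self, h.integral_eq_one]

end Mollifier

/-! ### Multiplication operators -/

section Multiplication

variable {d : ℕ} {Ω : Set (Pt d)} {χ : Pt d → ℝ}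

theorem memLp_mul (f : L2 Ω) (hχ : Continuous χ) {C : ℝ} (hC : ∀ x, ‖χ x‖ ≤ C) :
    MemLp (fun x => χ x * f x) 2 (volume.restrict Ω) := by
  refine MemLp.of_le_mul (c := C) (Lp.memLp f)
    (hχ.aestronglyMeasurable.mul (Lp.aestronglyMeasurable f)) (.of_forall fun x => ?_)
  rw [norm_mul]
  gcongr
  exact hC x

/-- Multiplication by a continuous compactly supported function, as an operator on `L²(Ω)`. -/
noncomputable def mulL (Ω : Set (Pt d)) (hχ : Continuous χ) (hc : HasCompactSupport χ) :
    L2 Ω →L[ℝ] L2 Ω :=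
  LinearMap.mkContinuous
    { toFun := fun f => (memLp_mul f hχ (exists_bound_of_continuous hχ hc).choose_spec.2).toLp _
      map_add' := fun f g => by
        rw [← MemLp.toLp_add]
        refine MemLp.toLp_congr _ _ ?_
        filter_upwards [Lp.coeFn_add f g] with y hy
        rw [hy, Pi.add_apply, Pi.add_apply, mul_add]
      map_smul' := fun a f => by
        rw [RingHom.id_apply, ← MemLp.toLp_const_smul]
        refine MemLp.toLp_congr _ _ ?_
        filter_upwards [Lp.coeFn_smul a f] with y hy
        rw [hy, Pi.smul_apply, Pi.smul_apply, smul_eq_mul, smul_eq_mul, mul_left_comm] }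
    (exists_bound_of_continuous hχ hc).choose fun f => by
      refine Lp.norm_le_mul_norm_of_ae_le_mul ?_
      filter_upwards [(memLp_mul f hχ (exists_bound_of_continuous hχ hc).choose_spec.2).coeFn_toLp]
        with x hx
      refine (congrArg norm hx).trans_le ?_
      rw [norm_mul]
      gcongr
      exact (exists_bound_of_continuous hχ hc).choose_spec.2 x

variable (hχ : Continuous χ) (hc : HasCompactSupport χ)

theorem coeFn_mulL (f : L2 Ω) :
    mulL Ω hχ hc f =ᵐ[volume.restrict Ω] fun x => χ x * f x :=
  (memLp_mul f hχ (exists_bound_of_continuous hχ hc).choose_spec.2).coeFn_toLp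

theorem norm_mulL_le {C : ℝ} (hC : ∀ x, |χ x| ≤ C) (f : L2 Ω) : ‖mulL Ω hχ hc f‖ ≤ C * ‖f‖ := by
  refine Lp.norm_le_mul_norm_of_ae_le_mul ?_
  filter_upwards [coeFn_mulL hχ hc f] with x hx
  rw [hx, norm_mul]
  gcongr
  exact hC x

end Multiplication

/-! ### Weak gradients of continuously differentiable functions -/

section WeakGradientOfSmooth

variable {d : ℕ} {Ω : Set (Pt d)}

theorem memLp_of_isBounded [IsFiniteMeasure (volume.restrict Ω)] (hΩ : Bornology.IsBounded Ω)
    (hΩm : MeasurableSet Ω)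
    {u : Pt d → ℝ} (hu : Continuous u) : MemLp u 2 (volume.restrict Ω) := by
  obtain ⟨C, hC⟩ := hΩ.isCompact_closure.exists_bound_of_continuousOn hu.continuousOn
  refine MemLp.of_bound hu.aestronglyMeasurable C ?_
  filter_upwards [ae_restrict_mem hΩm] with x hx
  exact hC x (subset_closure hx)

theorem integral_mul_pderiv {u ζ : Pt d → ℝ} (hu : ContDiff ℝ 1 u) (hζ : IsTest Ω ζ) (i : Fin d) :
    ∫ x in Ω, u x * pderiv i ζ x = -∫ x in Ω, pderiv i u x * ζ x := by
  have hu' : Continuous fun x => pderiv i u x :=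
    (hu.continuous_fderiv (by simp)).clm_apply continuous_const
  have hζc := hζ.contDiff.continuous
  have h0 : ∫ x in Ω, u x * pderiv i ζ x = ∫ x, u x * pderiv i ζ x := by
    refine setIntegral_eq_integral_of_forall_compl_eq_zero fun x hx => ?_
    have : x ∉ tsupport ζ := fun h => hx (hζ.tsupport_subset h)
    have h1 : fderiv ℝ ζ x = 0 := by
      by_contra h
      exact this (support_fderiv_subset ℝ h)
    rw [pderiv, h1, zero_apply, mul_zero]
  rw [h0, hζ.setIntegral_mul]
  refine integral_mul_fderiv_eq_neg_fderiv_mul_of_integrable ?_ ?_ ?_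
    (fun x _ => hu.differentiable (by simp) x) (fun x _ => hζ.contDiff.differentiable (by simp) x)
  · exact (hu'.mul hζc).integrable_of_hasCompactSupport hζ.hasCompactSupport.mul_left
  · exact (hu.continuous.mul (hζ.continuous_pderiv i)).integrable_of_hasCompactSupport
      (hζ.hasCompactSupport_pderiv i).mul_left
  · exact (hu.continuous.mul hζc).integrable_of_hasCompactSupport hζ.hasCompactSupport.mul_left

theorem IsTest.exists_isWeakGrad {ζ : Pt d → ℝ} (hζ : IsTest Ω ζ) :
    ∃ g, IsWeakGrad hζ.toL2 g := by
  have hm : ∀ i, MemLp (pderiv i ζ) 2 (volume.restrict Ω) := fun i =>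
    (hζ.continuous_pderiv i).memLp_of_hasCompactSupport (hζ.hasCompactSupport_pderiv i)
  refine ⟨fun i => (hm i).toLp, fun ξ hξ i => ?_⟩
  have h := integral_mul_pderiv (hζ.contDiff.of_le (by simp)) hξ i
  calc _ = ∫ x in Ω, ζ x * pderiv i ξ x := by
        refine integral_congr_ae ?_
        filter_upwards [hζ.coeFn_toL2] with x hx
        rw [hx]
    _ = _ := h
    _ = _ := by
        congr 1
        refine integral_congr_ae ?_
        filter_upwards [(hm i).coeFn_toLp] with x hx
        rw [hx]

end WeakGradientOfSmooth

/-! ### Smoothing operators adapted to the domain -/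

section Smoothing

variable {d : ℕ} {Ω : Set (Pt d)} {ι : Type} [Fintype ι]

theorem InwardPartition.exists_bound (P : InwardPartition Ω ι) :
    ∃ C, 0 ≤ C ∧ ∀ k x, |P.toFun k x| ≤ C ∧ ‖fderiv ℝ (P.toFun k) x‖ ≤ C := by
  choose C hC0 hC using fun k => exists_bound_of_continuous (P.contDiff k).continuous
    (P.hasCompactSupport k)
  choose D hD0 hD using fun k => exists_bound_of_continuous
    ((P.contDiff k).continuous_fderiv (by simp)) ((P.hasCompactSupport k).fderiv (𝕜 := ℝ))
  have h1 : ∀ k, C k + D k ≤ ∑ k, (C k + D k) := fun k =>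
    Finset.single_le_sum (fun i _ => add_nonneg (hC0 i) (hD0 i)) (Finset.mem_univ k)
  refine ⟨∑ k, (C k + D k), Finset.sum_nonneg fun i _ => add_nonneg (hC0 i) (hD0 i),
    fun k x => ⟨?_, ?_⟩⟩
  · exact (hC k x).trans ((le_add_of_nonneg_right (hD0 k)).trans (h1 k))
  · exact (hD k x).trans ((le_add_of_nonneg_left (hC0 k)).trans (h1 k))

/-- Multiplication by a member of the partition of unity. -/
noncomputable abbrev InwardPartition.cut (P : InwardPartition Ω ι) (k : ι) : L2 Ω →L[ℝ] L2 Ω :=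
  mulL Ω (P.contDiff k).continuous (P.hasCompactSupport k)

theorem InwardPartition.sum_cut (P : InwardPartition Ω ι) (hΩ : MeasurableSet Ω) (f : L2 Ω) :
    ∑ k, P.cut k f = f := by
  refine Lp.ext ?_
  have h1 : ∀ᵐ x ∂(volume.restrict Ω), ∀ k, P.cut k f x = P.toFun k x * f x :=
    ae_all_iff.2 fun k => coeFn_mulL _ _ f
  filter_upwards [Lp.coeFn_finsetSum Finset.univ fun k => P.cut k f, h1, ae_restrict_mem hΩ]
    with x hx h2 h3
  rw [hx, Finset.sum_apply]
  simp_rw [h2]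
  rw [← Finset.sum_mul, P.sum_eq_one x h3, one_mul]

variable [IsFiniteMeasure (volume.restrict Ω)]

theorem norm_convL_mollifier_le {κ : Pt d → ℝ} {a : Pt d} {δ : ℝ} (hκ : IsMollifier κ a δ)
    (f : L2 Ω) : ‖convL Ω hκ.continuous hκ.hasCompactSupport f‖ ≤ ‖f‖ := by
  have h := norm_convL_le (Ω := Ω) hκ.continuous hκ.hasCompactSupport
  rw [hκ.integral_norm] at h
  simpa using (convL Ω hκ.continuous hκ.hasCompactSupport).le_of_opNorm_le h f

/-- Cut off by the partition of unity, translate inwards by `t • P.dir k`, and mollify. -/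
noncomputable def InwardPartition.smoothing (P : InwardPartition Ω ι) {ρ : Pt d → ℝ} {δ : ℝ}
    (hρ : IsMollifier ρ 0 δ) (t : ℝ) : L2 Ω →L[ℝ] L2 Ω :=
  ∑ k, (convL Ω (hρ.translate (t • P.dir k)).continuous
    (hρ.translate (t • P.dir k)).hasCompactSupport) ∘L P.cut k

theorem InwardPartition.smoothing_apply (P : InwardPartition Ω ι) {ρ : Pt d → ℝ} {δ : ℝ}
    (hρ : IsMollifier ρ 0 δ) (t : ℝ) (f : L2 Ω) : P.smoothing hρ t f =
      ∑ k, convL Ω (hρ.translate (t • P.dir k)).continuous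
        (hρ.translate (t • P.dir k)).hasCompactSupport (P.cut k f) := by
  simp [smoothing]

theorem InwardPartition.isCompactOperator_smoothing (P : InwardPartition Ω ι)
    (hΩ : Bornology.IsBounded Ω) (hΩm : MeasurableSet Ω) {ρ : Pt d → ℝ} {δ : ℝ}
    (hρ : IsMollifier ρ 0 δ) (t : ℝ) : IsCompactOperator (P.smoothing hρ t) := by
  have hκ := fun k => hρ.translate (t • P.dir k)
  have : P.smoothing hρ t ∈ compactOperator (RingHom.id ℝ) (L2 Ω) (L2 Ω) :=
    Submodule.sum_mem _ fun k _ => (isCompactOperator_convL (hκ k).continuous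
      (hκ k).hasCompactSupport hΩ hΩm).comp_clm (P.cut k)
  exact this

theorem InwardPartition.norm_smoothing_le (P : InwardPartition Ω ι) :
    ∃ C, 0 ≤ C ∧ ∀ (ρ : Pt d → ℝ) (δ t : ℝ) (hρ : IsMollifier ρ 0 δ) (f : L2 Ω),
      ‖P.smoothing hρ t f‖ ≤ C * ‖f‖ := by
  obtain ⟨C, hC0, hC⟩ := P.exists_bound
  refine ⟨Fintype.card ι * C, by positivity, fun ρ δ t hρ f => ?_⟩
  rw [P.smoothing_apply]
  refine (norm_sum_le _ _).trans ?_
  calc _ ≤ ∑ k : ι, C * ‖f‖ := Finset.sum_le_sum fun k _ =>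
        (norm_convL_mollifier_le (hρ.translate (t • P.dir k)) _).trans (norm_mulL_le _ _ (fun x => (hC k x).1) f)
    _ = _ := by rw [Finset.sum_const, Finset.card_univ, nsmul_eq_mul, mul_assoc]

/-- The smoothing operators approximate functions in `W^{1,2}(Ω)` to first order in `L²(Ω)`. -/
theorem InwardPartition.norm_smoothing_sub_le (P : InwardPartition Ω ι) (hΩ : IsOpen Ω) :
    ∃ M, 0 ≤ M ∧ ∀ (ρ : Pt d → ℝ) (t : ℝ) (hρ : IsMollifier ρ 0 (P.aperture * t)), 0 < t →
      t ≤ P.maxTime → ∀ (f : L2 Ω) (g : Fin d → L2 Ω), IsWeakGrad f g →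
        ‖P.smoothing hρ t f - f‖ ≤ M * t * (‖f‖ + ∑ i, ‖g i‖) := by
  obtain ⟨C, hC0, hC⟩ := P.exists_bound
  have hap := P.aperture_pos
  -- On the support of the shifted kernel `‖z‖ ≤ (1 + P.aperture) * t`: a translation of length at
  -- most `t` plus the mollifier radius. The factor `Fintype.card ι` counts the pieces.
  refine ⟨Fintype.card ι * ((1 + P.aperture) * C), by positivity,
    fun ρ t hρ ht htm f g hfg => ?_⟩
  set N := ‖f‖ + ∑ i, ‖g i‖
  have hN : 0 ≤ N := by positivity
  have hmain : ∀ k, ‖convL Ω (hρ.translate (t • P.dir k)).continuous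
      (hρ.translate (t • P.dir k)).hasCompactSupport (P.cut k f) - P.cut k f‖ ≤
      (1 + P.aperture) * t * (C * N) := by
    intro k
    have hκ := hρ.translate (t • P.dir k)
    refine L2.norm_le_of_forall_test hΩ (by positivity) fun ζ hζ => ?_
    have hpair : ∀ z, ∫ y in Ω, (P.cut k f) y * ζ (y + z) =
        ∫ y in Ω, f y * (P.toFun k y * ζ (y - -z)) := by
      intro z
      refine integral_congr_ae ?_
      filter_upwards [coeFn_mulL (P.contDiff k).continuous (P.hasCompactSupport k) f] with y hy
      rw [hy, sub_neg_eq_add]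
      ring
    have heq : ∫ x in Ω, (convL Ω hκ.continuous hκ.hasCompactSupport (P.cut k f) -
        P.cut k f : L2 Ω) x * ζ x =
        (∫ x in Ω, conv (volume.restrict Ω) (P.cut k f) (fun z => ρ (z + t • P.dir k)) x * ζ x) -
          ∫ y in Ω, (P.cut k f) y * ζ y := by
      rw [← hζ.inner_toL2, inner_sub_left, hζ.inner_toL2, hζ.inner_toL2]
      congr 1
      refine integral_congr_ae ?_
      filter_upwards [coeFn_convL hκ.continuous hκ.hasCompactSupport (P.cut k f)] with y hy
      rw [hy]
    rw [heq]
    -- The kernel is a probability density, so it suffices to compare with each single translate in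
    -- its support; there `-z` lies in the inward cone of the `k`-th piece.
    refine abs_integral_conv_mul_sub_le (P.cut k f).integrable hκ.continuous hκ.hasCompactSupport
      hκ.nonneg hκ.integral_eq_one hζ fun z hz => ?_
    have hz' : ‖-z - t • P.dir k‖ ≤ P.aperture * t := by
      have := hκ.norm_sub_le hz
      rwa [zero_sub, sub_neg_eq_add, ← norm_neg, neg_add, ← sub_eq_add_neg] at this
    have hzn : ‖-z‖ ≤ (1 + P.aperture) * t := by
      calc ‖-z‖ = ‖(-z - t • P.dir k) + t • P.dir k‖ := by rw [sub_add_cancel]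
        _ ≤ P.aperture * t + t * 1 := by
          refine (norm_add_le _ _).trans (add_le_add hz' ?_)
          rw [norm_smul, Real.norm_eq_abs, abs_of_pos ht]
          gcongr
          exact P.norm_dir_le k
        _ = _ := by ring
    have hzero := hpair 0
    simp only [add_zero, neg_zero, sub_zero] at hzero
    rw [hpair z, hzero]
    refine (hfg.abs_integral_translate_sub_le hζ (P.contDiff k) (fun x => (hC k x).1)
      (fun x => (hC k x).2) (-z) fun s hs0 hs1 y hy hyz => ?_).trans ?_
    · exact P.add_smul_mem k t s (-z) y ht htm hz' hs0 hs1 hy hyz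
    · gcongr
  have hsub : P.smoothing hρ t f - f = ∑ k, (convL Ω (hρ.translate (t • P.dir k)).continuous
      (hρ.translate (t • P.dir k)).hasCompactSupport (P.cut k f) - P.cut k f) := by
    rw [Finset.sum_sub_distrib, P.sum_cut hΩ.measurableSet, P.smoothing_apply]
  rw [hsub]
  refine (norm_sum_le _ _).trans ((Finset.sum_le_sum fun k _ => hmain k).trans_eq ?_)
  rw [Finset.sum_const, Finset.card_univ, nsmul_eq_mul]
  ring

/-- The smoothing operators converge strongly to the identity of `L²(Ω)`. -/
theorem InwardPartition.exists_norm_smoothing_sub_lt (P : InwardPartition Ω ι) (hΩ : IsOpen Ω)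
    (f : L2 Ω) {ε : ℝ} (hε : 0 < ε) :
    ∃ t₁, 0 < t₁ ∧ ∀ (ρ : Pt d → ℝ) (t : ℝ) (hρ : IsMollifier ρ 0 (P.aperture * t)), 0 < t →
      t ≤ P.maxTime → t ≤ t₁ → ‖P.smoothing hρ t f - f‖ < ε := by
  obtain ⟨C, hC0, hC⟩ := P.norm_smoothing_le
  obtain ⟨M, hM0, hM⟩ := P.norm_smoothing_sub_le hΩ
  -- A test function has a weak gradient, so the first order estimate applies to it; the remainder
  -- is controlled by the bound on the smoothing operators, uniform in `t`.
  obtain ⟨u, ⟨ζ, hζ, rfl⟩, hu⟩ := Metric.mem_closure_iff.1 (dense_testSubmodule hΩ f)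
    (ε / (2 * (C + 1))) (by positivity)
  obtain ⟨g, hg⟩ := hζ.exists_isWeakGrad
  set N := ‖hζ.toL2‖ + ∑ i, ‖g i‖
  have hN : 0 ≤ N := by positivity
  refine ⟨ε / (2 * (M * N + 1)), by positivity, fun ρ t hρ ht htm ht₁ => ?_⟩
  have h1 := hM ρ t hρ ht htm _ _ hg
  have h2 := hC ρ _ t hρ (f - hζ.toL2)
  rw [dist_eq_norm] at hu
  have h3 : P.smoothing hρ t f - f = P.smoothing hρ t (f - hζ.toL2) - (f - hζ.toL2) +
      (P.smoothing hρ t hζ.toL2 - hζ.toL2) := by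
    rw [map_sub]
    abel
  have h4 : (C + 1) * ‖f - hζ.toL2‖ < ε / 2 := by
    rw [lt_div_iff₀ (by positivity)] at hu
    linarith
  have h5 : M * t * N ≤ ε / 2 := by
    rw [le_div_iff₀ (by positivity)] at ht₁
    nlinarith
  calc ‖P.smoothing hρ t f - f‖
      ≤ ‖P.smoothing hρ t (f - hζ.toL2)‖ + ‖f - hζ.toL2‖ + ‖P.smoothing hρ t hζ.toL2 - hζ.toL2‖ := by
        rw [h3]
        exact (norm_add_le _ _).trans (add_le_add_left (norm_sub_le _ _) _)
    _ ≤ C * ‖f - hζ.toL2‖ + ‖f - hζ.toL2‖ + M * t * N := by gcongr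
    _ < ε := by linarith

end Smoothing

/-! ### Entries of vector and tensor fields -/

section Entries

variable {d : ℕ} {Ω : Set (Pt d)} {α : Type*} [Fintype α]

/-- An entry of a field in `L²(Ω)`. -/
noncomputable def entry (Ω : Set (Pt d)) (a : α) :
    Lp (EuclideanSpace ℝ α) 2 (volume.restrict Ω) →L[ℝ] L2 Ω :=
  (EuclideanSpace.proj a : EuclideanSpace ℝ α →L[ℝ] ℝ).compLpL 2 (volume.restrict Ω)

theorem coeFn_entry (a : α) (f : Lp (EuclideanSpace ℝ α) 2 (volume.restrict Ω)) :
    entry Ω a f =ᵐ[volume.restrict Ω] fun x => f x a :=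
  (EuclideanSpace.proj a : EuclideanSpace ℝ α →L[ℝ] ℝ).coeFn_compLpL f

theorem norm_entry_le (a : α) (f : Lp (EuclideanSpace ℝ α) 2 (volume.restrict Ω)) :
    ‖entry Ω a f‖ ≤ ‖f‖ := by
  refine Lp.norm_le_norm_of_ae_le ?_
  filter_upwards [coeFn_entry a f] with x hx
  rw [hx]
  exact PiLp.norm_apply_le (f x) a

theorem entry_ext {f g : Lp (EuclideanSpace ℝ α) 2 (volume.restrict Ω)}
    (h : ∀ a, entry Ω a f = entry Ω a g) : f = g := by
  refine Lp.ext ?_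
  have h1 : ∀ᵐ x ∂(volume.restrict Ω), ∀ a, entry Ω a f x = f x a :=
    ae_all_iff.2 fun a => coeFn_entry a f
  have h2 : ∀ᵐ x ∂(volume.restrict Ω), ∀ a, entry Ω a g x = g x a :=
    ae_all_iff.2 fun a => coeFn_entry a g
  filter_upwards [h1, h2] with x h1 h2
  ext a
  rw [← h1, ← h2, h a]

variable [DecidableEq α]

/-- The field in `L²(Ω)` whose only nonzero entry is the given function. -/
noncomputable def ofEntry (Ω : Set (Pt d)) (a : α) :
    L2 Ω →L[ℝ] Lp (EuclideanSpace ℝ α) 2 (volume.restrict Ω) :=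
  (ContinuousLinearMap.toSpanSingleton ℝ (EuclideanSpace.single a (1 : ℝ))).compLpL 2
    (volume.restrict Ω)

theorem norm_ofEntry_le (a : α) (f : L2 Ω) : ‖ofEntry Ω a f‖ ≤ ‖f‖ := by
  refine Lp.norm_le_norm_of_ae_le ?_
  filter_upwards [(ContinuousLinearMap.toSpanSingleton ℝ
    (EuclideanSpace.single a (1 : ℝ))).coeFn_compLpL f] with x hx
  refine (congrArg norm hx).trans_le ?_
  simp [norm_smul]

theorem entry_ofEntry (a b : α) (f : L2 Ω) :
    entry Ω b (ofEntry Ω a f) = if b = a then f else 0 := by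
  refine Lp.ext ?_
  filter_upwards [coeFn_entry b (ofEntry Ω a f), (ContinuousLinearMap.toSpanSingleton ℝ
    (EuclideanSpace.single a (1 : ℝ))).coeFn_compLpL f, Lp.coeFn_zero ℝ 2 (volume.restrict Ω)]
    with x hx hx' h0
  rw [hx]
  change (((ContinuousLinearMap.toSpanSingleton ℝ
    (EuclideanSpace.single a (1 : ℝ))).compLpL 2 (volume.restrict Ω) f) x).ofLp b = _
  rw [hx']
  split_ifs with h
  · subst h; simp
  · rw [h0]; simp [h]

theorem sum_ofEntry_entry (f : Lp (EuclideanSpace ℝ α) 2 (volume.restrict Ω)) :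
    ∑ a, ofEntry Ω a (entry Ω a f) = f := by
  refine entry_ext fun b => ?_
  rw [map_sum]
  simp_rw [entry_ofEntry]
  simp

theorem norm_le_sum_entry (f : Lp (EuclideanSpace ℝ α) 2 (volume.restrict Ω)) :
    ‖f‖ ≤ ∑ a, ‖entry Ω a f‖ := by
  conv_lhs => rw [← sum_ofEntry_entry f]
  exact (norm_sum_le _ _).trans (Finset.sum_le_sum fun a _ => norm_ofEntry_le a _)

end Entries

/-! ### The spaces `H(Ω)` and `W(Ω)`: closedness, and Rellich's theorem -/

section Conditions

variable {d : ℕ} {Ω : Set (Pt d)}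

theorem IsTest.pderiv {ζ : Pt d → ℝ} (hζ : IsTest Ω ζ) (i : Fin d) : IsTest Ω (pderiv i ζ) where
  contDiff := (hζ.contDiff.fderiv_right (m := ∞) (by simp)).clm_apply contDiff_const
  hasCompactSupport := hζ.hasCompactSupport_pderiv i
  tsupport_subset := (tsupport_fderiv_apply_subset ℝ _).trans hζ.tsupport_subset

theorem setIntegral_entry_mul {α : Type*} [Fintype α] (a : α)
    (f : Lp (EuclideanSpace ℝ α) 2 (volume.restrict Ω)) (u : Pt d → ℝ) :
    ∫ x in Ω, entry Ω a f x * u x = ∫ x in Ω, f x a * u x := by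
  refine integral_congr_ae ?_
  filter_upwards [coeFn_entry a f] with x hx
  rw [hx]

theorem hasWeakGradient_iff {Φ : L2Mat Ω} {G : L2Ten Ω} : HasWeakGradient Φ G ↔
    ∀ i j, IsWeakGrad (entry Ω (i, j) Φ) fun k => entry Ω (k, i, j) G := by
  simp only [HasWeakGradient, IsWeakGrad, setIntegral_entry_mul]
  exact ⟨fun h i j ζ hζ k => h ζ hζ k i j, fun h ζ hζ k i j => h i j ζ hζ k⟩

/-- Pairing with a fixed test function or its derivative is an `L²` scalar product, so each defining
equation is a closed condition. -/
theorem isClosed_setOf_isWeakGrad {X : Type*} [TopologicalSpace X] {f : X → L2 Ω}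
    {g : X → Fin d → L2 Ω} (hf : Continuous f) (hg : ∀ i, Continuous fun x => g x i) :
    IsClosed {x | IsWeakGrad (f x) (g x)} := by
  simp only [IsWeakGrad, Set.ofPred_forall]
  refine isClosed_iInter fun ζ => isClosed_iInter fun hζ => isClosed_iInter fun i => ?_
  simp_rw [← (hζ.pderiv i).inner_toL2, ← hζ.inner_toL2]
  exact isClosed_eq (hf.inner continuous_const) ((hg i).inner continuous_const).neg

/-- The vector field `u` is divergence free in the sense of distributions. -/
def IsDivFreeVec (u : Fin d → L2 Ω) : Prop :=
  ∀ ζ : Pt d → ℝ, IsTest Ω ζ → ∑ i, ∫ x in Ω, u i x * pderiv i ζ x = 0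

/-- The columns decouple: test with `ζ` times a coordinate vector in one direction, and with the
coordinates of a vector test function in the other. -/
theorem isDivFree_iff {Φ : L2Mat Ω} :
    IsDivFree Φ ↔ ∀ j, IsDivFreeVec fun i => entry Ω (i, j) Φ := by
  simp only [IsDivFree, IsDivFreeVec, setIntegral_entry_mul]
  have hint : ∀ (ζ : Pt d → ℝ), IsTest Ω ζ → ∀ i j,
      Integrable (fun x => Φ x (i, j) * pderiv i ζ x) (volume.restrict Ω) := fun ζ hζ i j =>
    integrable_coord_mul Φ (i, j) (hζ.continuous_pderiv i) (hζ.hasCompactSupport_pderiv i)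
  constructor
  · intro h j ζ hζ
    have htest : IsTest Ω fun x => ζ x • (EuclideanSpace.single j 1 : Pt d) :=
      ⟨hζ.contDiff.smul contDiff_const, hζ.hasCompactSupport.smul_right,
        (tsupport_smul_subset_left ζ _).trans hζ.tsupport_subset⟩
    have hp : ∀ i l x, DivFree.pderiv i (fun x => ζ x • (EuclideanSpace.single j 1 : Pt d)) x l =
        if l = j then DivFree.pderiv i ζ x else 0 := by
      intro i l x
      have h1 : HasFDerivAt ζ (fderiv ℝ ζ x) x :=
        (hζ.contDiff.differentiable (by simp) _).hasFDerivAt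
      rw [DivFree.pderiv, (h1.smul_const _).fderiv]
      simp [DivFree.pderiv]
    rw [← h _ htest, ← integral_finsetSum _ fun i _ => hint ζ hζ i j]
    refine integral_congr_ae (.of_forall fun x => Finset.sum_congr rfl fun i _ => ?_)
    simp_rw [hp]
    simp
  · intro h φ hφ
    have hcoord : ∀ j, IsTest Ω fun x => φ x j := fun j =>
      ⟨(contDiff_euclidean.1 hφ.contDiff) j,
        hφ.hasCompactSupport.comp_left (g := fun v : Pt d => v j) rfl,
        (tsupport_comp_subset (g := fun v : Pt d => v j) rfl φ).trans hφ.tsupport_subset⟩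
    have hp : ∀ i j x, DivFree.pderiv i φ x j = DivFree.pderiv i (fun x => φ x j) x := by
      intro i j x
      have h1 : HasFDerivAt φ (fderiv ℝ φ x) x :=
        (hφ.contDiff.differentiable (by simp) _).hasFDerivAt
      have h2 : HasFDerivAt (fun x => φ x j)
          ((EuclideanSpace.proj j : Pt d →L[ℝ] ℝ) ∘L fderiv ℝ φ x) x :=
        ((EuclideanSpace.proj j : Pt d →L[ℝ] ℝ).hasFDerivAt.comp x h1 :)
      rw [DivFree.pderiv, DivFree.pderiv, h2.fderiv]
      rfl
    simp_rw [hp]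
    rw [integral_finsetSum _ fun i _ => integrable_finsetSum _ fun j _ => hint _ (hcoord j) i j]
    simp_rw [integral_finsetSum Finset.univ fun j _ => hint _ (hcoord j) _ j]
    rw [Finset.sum_comm]
    exact Finset.sum_eq_zero fun j _ => h j _ (hcoord j)

theorem isClosed_HSpace : IsClosed (HSpace Ω : Set (L2Mat Ω)) := by
  have : (HSpace Ω : Set (L2Mat Ω)) = {Φ | ∀ j, IsDivFreeVec fun i => entry Ω (i, j) Φ} :=
    Set.ext fun Φ => isDivFree_iff
  rw [this]
  simp only [IsDivFreeVec, Set.ofPred_forall]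
  refine isClosed_iInter fun j => isClosed_iInter fun ζ => isClosed_iInter fun hζ => ?_
  simp_rw [← (hζ.pderiv _).inner_toL2]
  exact isClosed_eq (continuous_finsetSum _ fun i _ =>
    ((entry Ω (i, j)).continuous.inner continuous_const)) continuous_const

theorem isClosed_WSpace : IsClosed (WSpace Ω : Set (WithLp 2 (L2Mat Ω × L2Ten Ω))) := by
  have h1 : IsClosed (Sobolev Ω : Set (WithLp 2 (L2Mat Ω × L2Ten Ω))) := by
    have : (Sobolev Ω : Set (WithLp 2 (L2Mat Ω × L2Ten Ω))) =
        {p | ∀ i j, IsWeakGrad (entry Ω (i, j) p.fst) fun k => entry Ω (k, i, j) p.snd} :=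
      Set.ext fun p => hasWeakGradient_iff
    rw [this]
    simp only [Set.ofPred_forall]
    refine isClosed_iInter fun i => isClosed_iInter fun j => isClosed_setOf_isWeakGrad ?_ ?_
    · exact (entry Ω (i, j)).continuous.comp (WithLp.fstL 2 ℝ (L2Mat Ω) (L2Ten Ω)).continuous
    · exact fun k => (entry Ω (k, i, j)).continuous.comp
        (WithLp.sndL 2 ℝ (L2Mat Ω) (L2Ten Ω)).continuous
  exact h1.inter (isClosed_HSpace.preimage (WithLp.fstL 2 ℝ (L2Mat Ω) (L2Ten Ω)).continuous)

instance : CompleteSpace (WSpace Ω) := isClosed_WSpace.completeSpace_coe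

/-- The embedding of `W(Ω)` into `L²(Ω)`. -/
noncomputable def fieldL (Ω : Set (Pt d)) : WSpace Ω →L[ℝ] L2Mat Ω :=
  WithLp.fstL 2 ℝ (L2Mat Ω) (L2Ten Ω) ∘L (WSpace Ω).subtypeL

theorem WSpace.isWeakGrad (w : WSpace Ω) (i j : Fin d) :
    IsWeakGrad (entry Ω (i, j) (fieldL Ω w)) fun k => entry Ω (k, i, j) (WSpace.grad w) :=
  hasWeakGradient_iff.1 w.2.1 i j

theorem WSpace.inner_eq (v w : WSpace Ω) :
    inner ℝ v w = inner ℝ (fieldL Ω v) (fieldL Ω w) + inner ℝ (WSpace.grad v) (WSpace.grad w) :=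
  WithLp.prod_inner_apply _ _

theorem WSpace.norm_field_le (w : WSpace Ω) : ‖fieldL Ω w‖ ≤ ‖w‖ := WithLp.norm_fst_le _ _

theorem WSpace.norm_grad_le (w : WSpace Ω) : ‖WSpace.grad w‖ ≤ ‖w‖ := WithLp.norm_snd_le _ _

variable [IsFiniteMeasure (volume.restrict Ω)]

theorem IsWeakGrad.unique (hΩ : IsOpen Ω) {f : L2 Ω} {g g' : Fin d → L2 Ω} (h : IsWeakGrad f g)
    (h' : IsWeakGrad f g') (i : Fin d) : g i = g' i := by
  rw [← sub_eq_zero]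
  refine L2.eq_zero_of_forall_test hΩ fun ζ hζ => ?_
  rw [← hζ.inner_toL2, inner_sub_left, hζ.inner_toL2, hζ.inner_toL2, sub_eq_zero,
    ← neg_inj, ← h ζ hζ i, h' ζ hζ i]

/-- An element of `W(Ω)` is a field paired with its weak gradient, and the fundamental lemma makes
the gradient a function of the field. -/
theorem injective_fieldL (hΩ : IsOpen Ω) : Function.Injective (fieldL Ω) := by
  intro v w h
  have hg : WSpace.grad v = WSpace.grad w := entry_ext fun ⟨k, i, j⟩ => by
    have h1 := WSpace.isWeakGrad v i j
    rw [h] at h1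
    exact IsWeakGrad.unique hΩ h1 (WSpace.isWeakGrad w i j) k
  refine Subtype.ext ?_
  exact WithLp.ofLp_injective 2 (Prod.ext h hg)

/-- **Rellich's theorem** for divergence free fields on a bounded Lipschitz domain. -/
theorem InwardPartition.isCompactOperator_fieldL {ι : Type} [Fintype ι] (P : InwardPartition Ω ι)
    (hΩ : IsOpen Ω) (hb : Bornology.IsBounded Ω) : IsCompactOperator (fieldL Ω) := by
  refine isCompactOperator_of_forall_exists fun ε hε => ?_
  obtain ⟨M, hM0, hM⟩ := P.norm_smoothing_sub_le hΩ
  -- For each of the matrix entries, `1 + d` counts the entry and its `d` weak derivatives, each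
  -- bounded by `‖w‖`. The total smoothing error is at most `N * t * ‖w‖`, and `t` is chosen with `N
  -- * t ≤ ε`.
  set N : ℝ := Fintype.card (Fin d × Fin d) * (M * (1 + d))
  have hN : 0 ≤ N := by positivity
  set t := min P.maxTime (ε / (N + 1))
  have ht : 0 < t := lt_min P.maxTime_pos (by positivity)
  obtain ⟨ρ, hρ⟩ := exists_isMollifier (d := d) (mul_pos P.aperture_pos ht)
  have hT : ∀ a : Fin d × Fin d, (ofEntry Ω a ∘L P.smoothing hρ t ∘L entry Ω a ∘L fieldL Ω) ∈
      compactOperator (RingHom.id ℝ) (WSpace Ω) (L2Mat Ω) := fun a =>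
    ((P.isCompactOperator_smoothing hb hΩ.measurableSet hρ t).comp_clm
      (entry Ω a ∘L fieldL Ω)).clm_comp (ofEntry Ω a)
  refine ⟨∑ a, ofEntry Ω a ∘L P.smoothing hρ t ∘L entry Ω a ∘L fieldL Ω,
    Submodule.sum_mem _ fun a _ => hT a, ?_⟩
  intro w
  have hε' : N * t ≤ ε := by
    have h3 : t ≤ ε / (N + 1) := min_le_right _ _
    rw [le_div_iff₀ (by positivity)] at h3
    nlinarith
  have heq : (∑ a, ofEntry Ω a ∘L P.smoothing hρ t ∘L entry Ω a ∘L fieldL Ω) w - fieldL Ω w =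
      ∑ a, ofEntry Ω a (P.smoothing hρ t (entry Ω a (fieldL Ω w)) - entry Ω a (fieldL Ω w)) := by
    simp_rw [map_sub, Finset.sum_sub_distrib, sum_ofEntry_entry]
    simp
  rw [norm_sub_rev, heq]
  have hterm : ∀ a : Fin d × Fin d, ‖ofEntry Ω a (P.smoothing hρ t (entry Ω a (fieldL Ω w)) -
      entry Ω a (fieldL Ω w))‖ ≤ M * t * ((1 + d) * ‖w‖) := by
    rintro ⟨i, j⟩
    refine (norm_ofEntry_le _ _).trans
      ((hM ρ t hρ ht (min_le_left _ _) _ _ (WSpace.isWeakGrad w i j)).trans ?_)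
    gcongr
    have h1 : ‖entry Ω (i, j) (fieldL Ω w)‖ ≤ ‖w‖ := (norm_entry_le _ _).trans (WSpace.norm_field_le w)
    have h2 : ∑ k, ‖entry Ω (k, i, j) (WSpace.grad w)‖ ≤ ∑ k : Fin d, ‖w‖ :=
      Finset.sum_le_sum fun k _ => (norm_entry_le _ _).trans (WSpace.norm_grad_le w)
    rw [Finset.sum_const, Finset.card_univ, Fintype.card_fin, nsmul_eq_mul] at h2
    linarith
  refine (norm_sum_le _ _).trans ((Finset.sum_le_sum fun a _ => hterm a).trans ?_)
  rw [Finset.sum_const, Finset.card_univ, nsmul_eq_mul]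
  refine le_trans (le_of_eq ?_) (mul_le_mul_of_nonneg_right hε' (norm_nonneg w))
  ring

end Conditions

/-! ### Smooth divergence free fields -/

section SmoothFields

variable {d : ℕ} {Ω : Set (Pt d)}

theorem entry_sum_ofEntry {α : Type*} [Fintype α] [DecidableEq α] (F : α → L2 Ω) (b : α) :
    entry Ω b (∑ a, ofEntry Ω a (F a)) = F b := by
  rw [map_sum]
  simp_rw [entry_ofEntry]
  simp

variable [IsFiniteMeasure (volume.restrict Ω)]

/-- A continuously differentiable matrix field whose divergence vanishes in `Ω` is in `W(Ω)`. -/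
theorem exists_WSpace_of_contDiff (hΩ : IsOpen Ω) (hb : Bornology.IsBounded Ω)
    {u : Fin d → Fin d → Pt d → ℝ} (hu : ∀ i j, ContDiff ℝ 1 (u i j))
    (hdiv : ∀ j, ∀ x ∈ Ω, ∑ i, pderiv i (u i j) x = 0) :
    ∃ w : WSpace Ω, ∀ i j, entry Ω (i, j) (fieldL Ω w) =ᵐ[volume.restrict Ω] u i j := by
  have hu' : ∀ k i j, Continuous (pderiv k (u i j)) := fun k i j =>
    ((hu i j).continuous_fderiv (by simp)).clm_apply continuous_const
  have hm : ∀ i j, MemLp (u i j) 2 (volume.restrict Ω) := fun i j =>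
    memLp_of_isBounded hb hΩ.measurableSet (hu i j).continuous
  have hm' : ∀ k i j, MemLp (pderiv k (u i j)) 2 (volume.restrict Ω) := fun k i j =>
    memLp_of_isBounded hb hΩ.measurableSet (hu' k i j)
  let Φ : L2Mat Ω := ∑ a, ofEntry Ω a ((hm a.1 a.2).toLp _)
  let G : L2Ten Ω := ∑ a, ofEntry Ω a ((hm' a.1 a.2.1 a.2.2).toLp _)
  have hΦ : ∀ i j, entry Ω (i, j) Φ = (hm i j).toLp _ := fun i j => entry_sum_ofEntry _ _
  have hG : ∀ k i j, entry Ω (k, i, j) G = (hm' k i j).toLp _ := fun k i j => entry_sum_ofEntry _ _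
  have hae : ∀ i j, entry Ω (i, j) Φ =ᵐ[volume.restrict Ω] u i j := fun i j => by
    rw [hΦ]
    exact (hm i j).coeFn_toLp
  have hibp : ∀ ζ, IsTest Ω ζ → ∀ k i j, ∫ x in Ω, entry Ω (i, j) Φ x * pderiv k ζ x =
      -∫ x in Ω, pderiv k (u i j) x * ζ x := by
    intro ζ hζ k i j
    rw [← integral_mul_pderiv (hu i j) hζ k]
    refine integral_congr_ae ?_
    filter_upwards [hae i j] with x hx
    rw [hx]
  have hgrad : HasWeakGradient Φ G := by
    refine hasWeakGradient_iff.2 fun i j ζ hζ k => ?_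
    rw [hibp ζ hζ]
    congr 1
    refine integral_congr_ae ?_
    beta_reduce
    rw [hG]
    filter_upwards [(hm' k i j).coeFn_toLp] with x hx
    rw [hx]
  have hdf : IsDivFree Φ := by
    refine isDivFree_iff.2 fun j ζ hζ => ?_
    have hint : ∀ i, Integrable (fun x => pderiv i (u i j) x * ζ x) (volume.restrict Ω) := fun i =>
      ((hu' i i j).mul hζ.contDiff.continuous).integrable_of_hasCompactSupport
        hζ.hasCompactSupport.mul_left
    simp_rw [hibp ζ hζ]
    rw [Finset.sum_neg_distrib, ← integral_finsetSum _ fun i _ => hint i, neg_eq_zero]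
    refine (setIntegral_congr_fun (g := fun _ => (0 : ℝ)) hΩ.measurableSet fun x hx => ?_).trans
      (by simp)
    simp only [← Finset.sum_mul, hdiv j x hx, zero_mul]
  exact ⟨⟨WithLp.toLp 2 (Φ, G), hgrad, hdf⟩, hae⟩

end SmoothFields

/-! ### A primitive for the difference of two mollifiers -/

section SegmentKernel

variable {d : ℕ}

/-- The difference of a mollifier and its translate by `w` is the derivative along `w` of a
kernel with norm at most `1` in `L¹`. -/
theorem IsMollifier.exists_segment_kernel {ρ : Pt d → ℝ} {δ : ℝ} (hρ : IsMollifier ρ 0 δ)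
    (w : Pt d) : ∃ R : Pt d → ℝ, ContDiff ℝ 1 R ∧ HasCompactSupport R ∧ ∫ z, ‖R z‖ ≤ 1 ∧
      ∀ z, fderiv ℝ R z w = ρ (z + w) - ρ z := by
  let ψ : ℝ → Pt d := fun s => -(s • w)
  have hψ : Continuous ψ := by fun_prop
  -- `ν` is the uniform probability measure on the segment from `0` to `-w`. The kernel `R` is its
  -- convolution with `ρ`, that is `R z = ∫ s in 0..1, ρ (z + s • w)`; its derivative along `w` is
  -- computed by the fundamental theorem of calculus.
  let ν : Measure (Pt d) := (volume.restrict (Set.Ioc (0 : ℝ) 1)).map ψ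
  have hν : IsFiniteMeasure ν := inferInstance
  have hconv : ∀ {k : Pt d → ℝ}, Continuous k → ∀ z,
      conv ν (fun _ => 1) k z = ∫ s in (0 : ℝ)..1, k (z + s • w) := by
    intro k hk z
    rw [conv, integral_map hψ.aemeasurable (by fun_prop : Continuous _).aestronglyMeasurable,
      intervalIntegral.integral_of_le zero_le_one]
    simp [ψ]
  have hone : Integrable (fun _ : Pt d => (1 : ℝ)) ν := integrable_const 1
  have hρ1 : ContDiff ℝ 1 ρ := hρ.contDiff.of_le (by simp)
  have hρi : Integrable ρ volume := hρ.continuous.integrable_of_hasCompactSupport hρ.hasCompactSupport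
  have hRc := contDiff_conv hone hρ1 hρ.hasCompactSupport
  refine ⟨conv ν (fun _ => 1) ρ, hRc, ?_, ?_, ?_⟩
  · refine HasCompactSupport.intro (isCompact_closedBall (0 : Pt d) (δ + ‖w‖)) fun z hz => ?_
    rw [hconv hρ.continuous]
    refine (intervalIntegral.integral_congr (g := fun _ => (0 : ℝ)) fun s hs => ?_).trans (by simp)
    rw [Set.uIcc_of_le zero_le_one] at hs
    by_contra hne
    have h1 := hρ.norm_sub_le hne
    rw [sub_zero] at h1
    apply hz
    rw [mem_closedBall_zero_iff]
    calc ‖z‖ = ‖(z + s • w) - s • w‖ := by rw [add_sub_cancel_right]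
      _ ≤ δ + 1 * ‖w‖ := by
        refine (_root_.norm_sub_le _ _).trans (add_le_add h1 ?_)
        rw [norm_smul, Real.norm_eq_abs, abs_of_nonneg hs.1]
        gcongr
        exact hs.2
      _ = _ := by rw [one_mul]
  · have hnn : ∀ z, 0 ≤ conv ν (fun _ => 1) ρ z := fun z =>
      integral_nonneg fun y => by simpa using hρ.nonneg _
    have h1 : ∫ z, conv ν (fun _ => 1) ρ z = (∫ _, (1 : ℝ) ∂ν) * ∫ z, ρ z :=
      integral_convolution (ContinuousLinearMap.mul ℝ ℝ) hone hρi
    have h2 : ∫ _, (1 : ℝ) ∂ν = 1 := by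
      rw [integral_map hψ.aemeasurable aestronglyMeasurable_const]
      simp
    simp_rw [Real.norm_eq_abs, abs_of_nonneg (hnn _)]
    rw [h1, h2, hρ.integral_eq_one, one_mul]
  · intro z
    rw [fderiv_conv_apply hone hρ1 hρ.hasCompactSupport]
    have hc' : Continuous fun z => fderiv ℝ ρ z w :=
      (hρ1.continuous_fderiv (by simp)).clm_apply continuous_const
    rw [hconv hc']
    have hder : ∀ s ∈ Set.uIcc (0 : ℝ) 1,
        HasDerivAt (fun s : ℝ => ρ (z + s • w)) (fderiv ℝ ρ (z + s • w) w) s := by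
      intro s _
      have h1 : HasFDerivAt ρ (fderiv ℝ ρ (z + s • w)) (z + s • w) :=
        (hρ1.differentiable (by simp) _).hasFDerivAt
      have h2 : HasDerivAt (fun s : ℝ => z + s • w) w s := by
        simpa using ((hasDerivAt_id s).smul_const w).const_add z
      exact h1.comp_hasDerivAt s h2
    rw [intervalIntegral.integral_eq_sub_of_hasDerivAt hder
      ((by fun_prop : Continuous fun s : ℝ => fderiv ℝ ρ (z + s • w) w).intervalIntegrable _ _)]
    simp

end SegmentKernel

/-! ### Density of `W(Ω)` in `H(Ω)` -/

section Density

variable {d : ℕ} {Ω : Set (Pt d)} {ι : Type} [Fintype ι]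

theorem InwardPartition.continuous_pderiv (P : InwardPartition Ω ι) (k : ι) (i : Fin d) :
    Continuous (pderiv i (P.toFun k)) :=
  ((P.contDiff k).continuous_fderiv (by simp)).clm_apply continuous_const

theorem InwardPartition.hasCompactSupport_pderiv (P : InwardPartition Ω ι) (k : ι) (i : Fin d) :
    HasCompactSupport (pderiv i (P.toFun k)) :=
  (P.hasCompactSupport k).fderiv_apply (𝕜 := ℝ) _

/-- The divergence of `P.toFun k • u`, for a divergence free vector field `u`. -/
noncomputable def InwardPartition.cutDiv (P : InwardPartition Ω ι) (k : ι) (u : Fin d → L2 Ω) :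
    L2 Ω :=
  ∑ i, mulL Ω (P.continuous_pderiv k i) (P.hasCompactSupport_pderiv k i) (u i)

theorem InwardPartition.coeFn_cutDiv (P : InwardPartition Ω ι) (k : ι) (u : Fin d → L2 Ω) :
    P.cutDiv k u =ᵐ[volume.restrict Ω] fun x => ∑ i, pderiv i (P.toFun k) x * u i x := by
  have h1 : ∀ᵐ x ∂(volume.restrict Ω), ∀ i, mulL Ω (P.continuous_pderiv k i)
      (P.hasCompactSupport_pderiv k i) (u i) x = pderiv i (P.toFun k) x * u i x :=
    ae_all_iff.2 fun i => coeFn_mulL _ _ (u i)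
  filter_upwards [Lp.coeFn_fun_finsetSum Finset.univ fun i => mulL Ω (P.continuous_pderiv k i)
    (P.hasCompactSupport_pderiv k i) (u i), h1] with x hx h1
  rw [cutDiv, hx]
  simp_rw [h1]

theorem InwardPartition.sum_pderiv (P : InwardPartition Ω ι) (hΩ : IsOpen Ω) (i : Fin d)
    {x : Pt d} (hx : x ∈ Ω) : ∑ k, pderiv i (P.toFun k) x = 0 := by
  have h1 : HasFDerivAt (fun x => ∑ k, P.toFun k x) (∑ k, fderiv ℝ (P.toFun k) x) x :=
    HasFDerivAt.fun_sum fun k _ => ((P.contDiff k).differentiable (by simp) x).hasFDerivAt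
  have h2 : HasFDerivAt (fun x => ∑ k, P.toFun k x) (0 : Pt d →L[ℝ] ℝ) x := by
    refine (hasFDerivAt_const (1 : ℝ) x).congr_of_eventuallyEq ?_
    filter_upwards [hΩ.mem_nhds hx] with y hy
    exact P.sum_eq_one y hy
  have h3 := congrArg (fun L : Pt d →L[ℝ] ℝ => L (EuclideanSpace.single i 1)) (h1.unique h2)
  simpa [pderiv] using h3

/-- The cutoffs sum to one on the open set `Ω`, so their gradients sum to zero there. This
cancellation removes the divergence created by localizing. -/
theorem InwardPartition.sum_cutDiv (P : InwardPartition Ω ι) (hΩ : IsOpen Ω) (u : Fin d → L2 Ω) :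
    ∀ᵐ x ∂(volume.restrict Ω), ∑ k, P.cutDiv k u x = 0 := by
  have h1 : ∀ᵐ x ∂(volume.restrict Ω), ∀ k, P.cutDiv k u x =
      ∑ i, pderiv i (P.toFun k) x * u i x := ae_all_iff.2 fun k => P.coeFn_cutDiv k u
  filter_upwards [h1, ae_restrict_mem hΩ.measurableSet] with x h1 hx
  simp_rw [h1]
  rw [Finset.sum_comm]
  refine Finset.sum_eq_zero fun i _ => ?_
  rw [← Finset.sum_mul, P.sum_pderiv hΩ i hx, zero_mul]

theorem pderiv_conv {f κ : Pt d → ℝ} (hf : Integrable f (volume.restrict Ω)) (hκ : ContDiff ℝ 1 κ)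
    (hc : HasCompactSupport κ) (i : Fin d) (x : Pt d) :
    pderiv i (conv (volume.restrict Ω) f κ) x = conv (volume.restrict Ω) f (pderiv i κ) x :=
  fderiv_conv_apply hf hκ hc x _

variable [IsFiniteMeasure (volume.restrict Ω)]

/-- The divergence of the mollified translate of `P.toFun k • u`. -/
theorem InwardPartition.sum_conv_cut_pderiv (P : InwardPartition Ω ι) (k : ι) {u : Fin d → L2 Ω}
    (hu : IsDivFreeVec u) {ρ : Pt d → ℝ} {t : ℝ} (hρ : IsMollifier ρ 0 (P.aperture * t))
    (ht : 0 < t) (htm : t ≤ P.maxTime) {x : Pt d} (hx : x ∈ Ω) :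
    ∑ i, conv (volume.restrict Ω) (P.cut k (u i)) (pderiv i fun z => ρ (z + t • P.dir k)) x =
      conv (volume.restrict Ω) (P.cutDiv k u) (fun z => ρ (z + t • P.dir k)) x := by
  have hκ := hρ.translate (t • P.dir k)
  set κ : Pt d → ℝ := fun z => ρ (z + t • P.dir k)
  have hκ' : ∀ i, Continuous (pderiv i κ) := fun i =>
    (hκ.contDiff.continuous_fderiv (by simp)).clm_apply continuous_const
  have hκc' : ∀ i, HasCompactSupport (pderiv i κ) := fun i =>
    hκ.hasCompactSupport.fderiv_apply (𝕜 := ℝ) _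
  have hs : tsupport (fun y => κ (x - y)) = (fun y => x - y) ⁻¹' tsupport κ :=
    tsupport_comp_eq_preimage κ (Homeomorph.subLeft x)
  -- On the support of this function `y - x` lies in the inward cone, so `y` stays in `Ω`. Testing
  -- the divergence free `u` with it, the product rule trades the derivative of the kernel for the
  -- derivative of the cutoff.
  have htest : IsTest Ω fun y => P.toFun k y * κ (x - y) := by
    refine ⟨(P.contDiff k).mul (hκ.contDiff.comp (contDiff_const.sub contDiff_id)),
      (P.hasCompactSupport k).mul_right, fun y hy => ?_⟩
    have h1 : y ∈ tsupport (P.toFun k) := tsupport_mul_subset_left hy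
    have h2 : y ∈ tsupport fun y => κ (x - y) := tsupport_mul_subset_right hy
    rw [hs] at h2
    have h3 := hκ.tsupport_subset h2
    rw [Metric.mem_closedBall, dist_eq_norm] at h3
    have h4 : x + (1 : ℝ) • (y - x) = y := by rw [one_smul, add_sub_cancel]
    have h5 := P.add_smul_mem k t 1 (y - x) x ht htm ?_ zero_le_one le_rfl hx
    · rw [h4] at h5
      exact h5 h1
    · have h6 : y - x - t • P.dir k = -(x - y - (0 - t • P.dir k)) := by abel
      rw [h6, norm_neg]
      exact h3
  have hpd : ∀ i y, pderiv i (fun y => P.toFun k y * κ (x - y)) y =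
      pderiv i (P.toFun k) y * κ (x - y) - P.toFun k y * pderiv i κ (x - y) := by
    intro i y
    have h1 : HasFDerivAt κ (fderiv ℝ κ (x - y)) (x - y) :=
      (hκ.contDiff.differentiable (by simp) _).hasFDerivAt
    have h2 : HasFDerivAt (fun y => κ (x - y)) (-fderiv ℝ κ (x - y)) y := by
      have := h1.comp y ((hasFDerivAt_id y).const_sub x)
      rwa [ContinuousLinearMap.comp_neg, ContinuousLinearMap.comp_id] at this
    have h3 : HasFDerivAt (P.toFun k) (fderiv ℝ (P.toFun k) y) y :=
      ((P.contDiff k).differentiable (by simp) _).hasFDerivAt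
    have h4 : fderiv ℝ (fun y => P.toFun k y * κ (x - y)) y = _ := (h3.mul h2).fderiv
    rw [pderiv, h4]
    simp only [pderiv, add_apply, smul_apply, neg_apply, smul_eq_mul]
    ring
  have hi1 : ∀ i, Integrable (fun y => P.cut k (u i) y * pderiv i κ (x - y)) (volume.restrict Ω) :=
    fun i => integrable_mul_kernel (P.cut k (u i)).integrable (hκ' i) (hκc' i) x
  have hi2 : ∀ i, Integrable (fun y => mulL Ω (P.continuous_pderiv k i)
      (P.hasCompactSupport_pderiv k i) (u i) y * κ (x - y)) (volume.restrict Ω) :=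
    fun i => integrable_mul_kernel (L2.integrable _) hκ.continuous hκ.hasCompactSupport x
  have h0 := hu _ htest
  have hsplit : ∀ i, ∫ y in Ω, u i y * pderiv i (fun y => P.toFun k y * κ (x - y)) y =
      (∫ y in Ω, mulL Ω (P.continuous_pderiv k i) (P.hasCompactSupport_pderiv k i) (u i) y *
        κ (x - y)) - ∫ y in Ω, P.cut k (u i) y * pderiv i κ (x - y) := by
    intro i
    rw [← integral_sub (hi2 i) (hi1 i)]
    refine integral_congr_ae ?_
    filter_upwards [coeFn_mulL (P.continuous_pderiv k i) (P.hasCompactSupport_pderiv k i) (u i),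
      coeFn_mulL (P.contDiff k).continuous (P.hasCompactSupport k) (u i)] with y h1 h2
    rw [h1, h2, hpd]
    ring
  simp_rw [hsplit] at h0
  rw [Finset.sum_sub_distrib, sub_eq_zero] at h0
  simp only [conv]
  rw [← h0, ← integral_finsetSum _ fun i _ => hi2 i]
  refine integral_congr_ae ?_
  filter_upwards [Lp.coeFn_fun_finsetSum Finset.univ fun i => mulL Ω (P.continuous_pderiv k i)
    (P.hasCompactSupport_pderiv k i) (u i)] with y hy
  rw [cutDiv, hy, Finset.sum_mul]

/-- A divergence free vector field in `L²(Ω)` is approximated by its smoothing up to a correction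
of first order, which makes the approximation divergence free in `Ω`. -/
theorem InwardPartition.exists_contDiff_divFree (P : InwardPartition Ω ι) (hΩ : IsOpen Ω)
    {u : Fin d → L2 Ω} (hu : IsDivFreeVec u) {ρ : Pt d → ℝ} {t : ℝ}
    (hρ : IsMollifier ρ 0 (P.aperture * t)) (ht : 0 < t) (htm : t ≤ P.maxTime) :
    ∃ v : Fin d → Pt d → ℝ, (∀ i, ContDiff ℝ 1 (v i)) ∧
      (∀ x ∈ Ω, ∑ i, pderiv i (v i) x = 0) ∧
      ∀ i, ∃ f : L2 Ω, f =ᵐ[volume.restrict Ω] v i ∧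
        ‖f - P.smoothing hρ t (u i)‖ ≤ t * ∑ k, ‖P.cutDiv k u‖ := by
  choose R hR hRc hR1 hRd using fun k => hρ.exists_segment_kernel (t • P.dir k)
  have hκ := fun k => hρ.translate (t • P.dir k)
  have hκ1 : ∀ k, ContDiff ℝ 1 fun z => ρ (z + t • P.dir k) := fun k =>
    (hκ k).contDiff.of_le (by simp)
  set ν := volume.restrict Ω
  have hA : ∀ i k, ContDiff ℝ 1 (conv ν (P.cut k (u i)) fun z => ρ (z + t • P.dir k)) := fun i k =>
    contDiff_conv (L2.integrable _) (hκ1 k) (hκ k).hasCompactSupport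
  have hB : ∀ k, ContDiff ℝ 1 (conv ν (P.cutDiv k u) (R k)) := fun k =>
    contDiff_conv (L2.integrable _) (hR k) (hRc k)
  -- The first terms are the smoothing of `u i`, the second the correction. In the divergence, the
  -- `k`-th summand gives `cutDiv * ρ (· + t • dir) - cutDiv * (ρ (· + t • dir) - ρ) = cutDiv * ρ`,
  -- with the same kernel for every `k`, and the sum over `k` vanishes.
  refine ⟨fun i x => ∑ k, (conv ν (P.cut k (u i)) (fun z => ρ (z + t • P.dir k)) x -
    (t • P.dir k) i * conv ν (P.cutDiv k u) (R k) x), fun i => ?_, fun x hx => ?_, fun i => ?_⟩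
  · exact ContDiff.sum fun k _ => (hA i k).sub (contDiff_const.mul (hB k))
  · have hd : ∀ i, pderiv i (fun x => ∑ k, (conv ν (P.cut k (u i))
        (fun z => ρ (z + t • P.dir k)) x - (t • P.dir k) i * conv ν (P.cutDiv k u) (R k) x)) x =
        ∑ k, (conv ν (P.cut k (u i)) (pderiv i fun z => ρ (z + t • P.dir k)) x -
          (t • P.dir k) i * conv ν (P.cutDiv k u) (pderiv i (R k)) x) := by
      intro i
      have h1 := HasFDerivAt.fun_sum (u := Finset.univ) (x := x) fun k _ =>
        (((hA i k).differentiable (by simp) x).hasFDerivAt.sub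
          (((hB k).differentiable (by simp) x).hasFDerivAt.const_mul ((t • P.dir k) i)))
      have h2 : fderiv ℝ (fun x => ∑ k, (conv ν (P.cut k (u i))
        (fun z => ρ (z + t • P.dir k)) x - (t • P.dir k) i * conv ν (P.cutDiv k u) (R k) x)) x = _ :=
        h1.fderiv
      rw [pderiv, h2]
      simp only [sum_apply, sub_apply, smul_apply, smul_eq_mul]
      refine Finset.sum_congr rfl fun k _ => ?_
      rw [← pderiv_conv (L2.integrable _) (hκ1 k) (hκ k).hasCompactSupport,
        ← pderiv_conv (L2.integrable _) (hR k) (hRc k)]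
      rfl
    simp_rw [hd]
    rw [Finset.sum_comm]
    have hk : ∀ k, ∑ i, (conv ν (P.cut k (u i)) (pderiv i fun z => ρ (z + t • P.dir k)) x -
        (t • P.dir k) i * conv ν (P.cutDiv k u) (pderiv i (R k)) x) =
        conv ν (P.cutDiv k u) ρ x := by
      intro k
      have hRi : ∀ i, Integrable (fun y => P.cutDiv k u y * pderiv i (R k) (x - y)) ν := fun i =>
        integrable_mul_kernel (L2.integrable _)
          (((hR k).continuous_fderiv (by simp)).clm_apply continuous_const)
          ((hRc k).fderiv_apply (𝕜 := ℝ) _) x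
      rw [Finset.sum_sub_distrib, P.sum_conv_cut_pderiv k hu hρ ht htm hx]
      simp only [conv]
      simp_rw [← integral_const_mul]
      rw [← integral_finsetSum _ fun i _ => (hRi i).const_mul _, ← integral_sub]
      · refine integral_congr_ae (.of_forall fun y => ?_)
        simp only
        have h3 := hRd k (x - y)
        rw [fderiv_apply_eq_sum_pderiv] at h3
        simp_rw [mul_left_comm _ (P.cutDiv k u y)]
        rw [← Finset.mul_sum, h3]
        ring
      · exact integrable_mul_kernel (L2.integrable _) (hκ k).continuous (hκ k).hasCompactSupport x
      · exact integrable_finsetSum _ fun i _ => (hRi i).const_mul _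
    simp_rw [hk]
    simp only [conv]
    rw [← integral_finsetSum _ fun k _ =>
      integrable_mul_kernel (L2.integrable _) hρ.continuous hρ.hasCompactSupport x]
    refine (integral_congr_ae (g := fun _ => (0 : ℝ)) ?_).trans (by simp)
    filter_upwards [P.sum_cutDiv hΩ u] with y hy
    rw [← Finset.sum_mul, hy, zero_mul]
  · let g : ι → L2 Ω := fun k => convL Ω (hR k).continuous (hRc k) (P.cutDiv k u)
    refine ⟨P.smoothing hρ t (u i) - ∑ k, (t • P.dir k) i • g k, ?_, ?_⟩
    · rw [P.smoothing_apply, ← Finset.sum_sub_distrib]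
      have h1 : ∀ᵐ x ∂ν, ∀ k, (convL Ω (hκ k).continuous (hκ k).hasCompactSupport (P.cut k (u i)) -
          (t • P.dir k) i • g k : L2 Ω) x = conv ν (P.cut k (u i)) (fun z => ρ (z + t • P.dir k)) x -
            (t • P.dir k) i * conv ν (P.cutDiv k u) (R k) x := by
        refine ae_all_iff.2 fun k => ?_
        filter_upwards [Lp.coeFn_sub (convL Ω (hκ k).continuous (hκ k).hasCompactSupport
          (P.cut k (u i))) ((t • P.dir k) i • g k), Lp.coeFn_smul ((t • P.dir k) i) (g k),
          coeFn_convL (hκ k).continuous (hκ k).hasCompactSupport (P.cut k (u i)),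
          coeFn_convL (hR k).continuous (hRc k) (P.cutDiv k u)] with x h1 h2 h3 h4
        rw [h1, Pi.sub_apply, h2, Pi.smul_apply, h3, h4, smul_eq_mul]
      filter_upwards [Lp.coeFn_fun_finsetSum Finset.univ fun k => (convL Ω (hκ k).continuous
        (hκ k).hasCompactSupport (P.cut k (u i)) - (t • P.dir k) i • g k : L2 Ω), h1] with x h2 h1
      rw [h2]
      simp_rw [h1]
    · rw [sub_sub_cancel_left, norm_neg, Finset.mul_sum]
      refine (norm_sum_le _ _).trans (Finset.sum_le_sum fun k _ => ?_)
      rw [norm_smul]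
      have h1 : ‖(t • P.dir k) i‖ ≤ t := by
        refine (PiLp.norm_apply_le (t • P.dir k) i).trans ?_
        rw [norm_smul, Real.norm_eq_abs, abs_of_pos ht]
        exact mul_le_of_le_one_right ht.le (P.norm_dir_le k)
      have h2 : ‖g k‖ ≤ ‖P.cutDiv k u‖ := by
        have h3 := (convL Ω (hR k).continuous (hRc k)).le_of_opNorm_le
          ((norm_convL_le (Ω := Ω) (hR k).continuous (hRc k)).trans (hR1 k)) (P.cutDiv k u)
        rwa [one_mul] at h3
      gcongr

/-- The space `W(Ω)` is dense in `H(Ω)`. -/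
theorem InwardPartition.exists_norm_fieldL_sub_lt (P : InwardPartition Ω ι) (hΩ : IsOpen Ω)
    (hb : Bornology.IsBounded Ω) {Φ : L2Mat Ω} (hΦ : Φ ∈ HSpace Ω) {ε : ℝ} (hε : 0 < ε) :
    ∃ w : WSpace Ω, ‖fieldL Ω w - Φ‖ < ε := by
  have hcol : ∀ j, IsDivFreeVec fun i => entry Ω (i, j) Φ := isDivFree_iff.1 hΦ
  set N : ℝ := ((Fintype.card (Fin d × Fin d) : ℕ) : ℝ)
  -- Each of the `N` entries incurs two errors of size `η`, from smoothing and from the correction;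
  -- `N + 1` keeps the denominator positive and the final bound strict.
  set η : ℝ := ε / (2 * (N + 1))
  have hN : 0 ≤ N := by positivity
  have hη : 0 < η := by positivity
  have h1 : ∀ᶠ t in 𝓝[>] (0 : ℝ), ∀ a : Fin d × Fin d, ∀ (ρ : Pt d → ℝ)
      (hρ : IsMollifier ρ 0 (P.aperture * t)),
      ‖P.smoothing hρ t (entry Ω a Φ) - entry Ω a Φ‖ < η := by
    refine eventually_all.2 fun a => ?_
    obtain ⟨t₁, ht₁, h⟩ := P.exists_norm_smoothing_sub_lt hΩ (entry Ω a Φ) hη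
    filter_upwards [Ioc_mem_nhdsGT (lt_min ht₁ P.maxTime_pos)] with t ht ρ hρ
    exact h ρ t hρ ht.1 (ht.2.trans (min_le_right _ _)) (ht.2.trans (min_le_left _ _))
  have h2 : ∀ᶠ t in 𝓝[>] (0 : ℝ), ∀ j : Fin d,
      t * ∑ k, ‖P.cutDiv k fun i => entry Ω (i, j) Φ‖ < η := by
    refine eventually_all.2 fun j => ?_
    have : Tendsto (fun t : ℝ => t * ∑ k, ‖P.cutDiv k fun i => entry Ω (i, j) Φ‖) (𝓝[>] 0)
        (𝓝 (0 * ∑ k, ‖P.cutDiv k fun i => entry Ω (i, j) Φ‖)) :=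
      (tendsto_id.mono_left nhdsWithin_le_nhds).mul_const _
    rw [zero_mul] at this
    exact this.eventually_lt_const hη
  obtain ⟨t, h1, h2, ht⟩ := (h1.and (h2.and (Ioc_mem_nhdsGT P.maxTime_pos))).exists
  obtain ⟨ρ, hρ⟩ := exists_isMollifier (d := d) (mul_pos P.aperture_pos ht.1)
  choose v hv hdiv f hf hfn using fun j => P.exists_contDiff_divFree hΩ (hcol j) hρ ht.1 ht.2
  obtain ⟨w, hw⟩ := exists_WSpace_of_contDiff hΩ hb (u := fun i j => v j i) (fun i j => hv j i)
    (fun j x hx => hdiv j x hx)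
  refine ⟨w, ?_⟩
  have hterm : ∀ a : Fin d × Fin d, ‖entry Ω a (fieldL Ω w - Φ)‖ ≤ 2 * η := by
    rintro ⟨i, j⟩
    have h3 : entry Ω (i, j) (fieldL Ω w) = f j i := Lp.ext ((hw i j).trans (hf j i).symm)
    rw [map_sub, h3]
    calc _ = ‖(f j i - P.smoothing hρ t (entry Ω (i, j) Φ)) +
          (P.smoothing hρ t (entry Ω (i, j) Φ) - entry Ω (i, j) Φ)‖ := by rw [sub_add_sub_cancel]
      _ ≤ η + η := (norm_add_le _ _).trans
          (add_le_add ((hfn j i).trans (h2 j).le) (h1 (i, j) ρ hρ).le)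
      _ = _ := by ring
  have h4 : N * (2 * η) < ε := by
    have : 2 * (N + 1) * η = ε := mul_div_cancel₀ _ (by positivity)
    nlinarith
  calc _ ≤ ∑ a, ‖entry Ω a (fieldL Ω w - Φ)‖ := norm_le_sum_entry _
    _ ≤ ∑ a : Fin d × Fin d, 2 * η := Finset.sum_le_sum fun a _ => hterm a
    _ = N * (2 * η) := by rw [Finset.sum_const, Finset.card_univ, nsmul_eq_mul]
    _ < ε := h4

end Density

/-! ### The eigenvalue problem of an injective compact operator -/

section CompactEmbedding

variable {E F : Type*} [NormedAddCommGroup E] [InnerProductSpace ℝ E] [CompleteSpace E]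
  [NormedAddCommGroup F] [InnerProductSpace ℝ F] [CompleteSpace F]

theorem span_range_smul {E : Type*} [AddCommGroup E] [Module ℝ E] {a : ℕ → ℝ} (ha : ∀ n, a n ≠ 0)
    (v : ℕ → E) :
    Submodule.span ℝ (Set.range fun n => a n • v n) = Submodule.span ℝ (Set.range v) := by
  refine le_antisymm (Submodule.span_le.2 ?_) (Submodule.span_le.2 ?_)
  · rintro _ ⟨n, rfl⟩
    exact Submodule.smul_mem _ _ (Submodule.subset_span ⟨n, rfl⟩)
  · rintro _ ⟨n, rfl⟩
    have h := Submodule.smul_mem (Submodule.span ℝ (Set.range fun n => a n • v n)) (a n)⁻¹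
      (Submodule.subset_span ⟨n, rfl⟩)
    simpa [inv_smul_smul₀ (ha n)] using h

/-- The spectral theorem for the eigenvalue problem `⟪v, w⟫ = lam ⟪J v, J w⟫` associated with an
injective compact operator `J`. -/
theorem exists_eigenvectors_of_isCompactOperator {J : E →L[ℝ] F} (hJ : IsCompactOperator J)
    (hinj : Function.Injective J) (hinf : ¬ FiniteDimensional ℝ E) :
    ∃ (lam : ℕ → ℝ) (v : ℕ → E), Monotone lam ∧ Tendsto lam atTop atTop ∧
      (∀ n w, inner ℝ (v n) w = lam n * inner ℝ (J (v n)) (J w)) ∧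
      Orthonormal ℝ (fun n => J (v n)) ∧
      (∀ n x, (∀ i < n, inner ℝ (v i) x = 0) → lam n * ‖J x‖ ^ 2 ≤ ‖x‖ ^ 2) ∧
      IsOrthogonalBasis v := by
  have hS : ∀ v w, inner ℝ ((J.adjoint ∘L J) v) w = inner ℝ (J v) (J w) := fun v w =>
    ContinuousLinearMap.adjoint_inner_left J w (J v)
  have hsymm : ((J.adjoint ∘L J : E →L[ℝ] E) : E →ₗ[ℝ] E).IsSymmetric := fun v w => by
    change inner ℝ ((J.adjoint ∘L J) v) w = inner ℝ v ((J.adjoint ∘L J) w)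
    rw [hS, real_inner_comm ((J.adjoint ∘L J) w) v, hS, real_inner_comm]
  have hpos : ∀ w, w ≠ 0 → 0 < inner ℝ ((J.adjoint ∘L J) w) w := fun w hw => by
    rw [hS]
    exact real_inner_self_pos.2 ((map_ne_zero_iff _ hinj).2 hw)
  obtain ⟨v, c, hon, hv, hc, hanti, hlim, hmax, hspan⟩ :=
    exists_orthonormal_eigenvectors (hJ.clm_comp J.adjoint) hsymm hpos hinf
  have hinner : ∀ n w, inner ℝ (J (v n)) (J w) = c n * inner ℝ (v n) w := fun n w => by
    rw [← hS, hv, real_inner_smul_left]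
  have hv0 : ∀ n, v n ≠ 0 := hon.ne_zero
  have ha : ∀ n, ‖J (v n)‖ ≠ 0 := fun n => norm_ne_zero_iff.2 ((map_ne_zero_iff _ hinj).2 (hv0 n))
  have ha' : ∀ n, ‖J (v n)‖⁻¹ ≠ 0 := fun n => inv_ne_zero (ha n)
  have horth : Pairwise fun m n =>
      inner ℝ (‖J (v m)‖⁻¹ • v m) (‖J (v n)‖⁻¹ • v n) = 0 := fun m n hmn => by
    beta_reduce
    rw [real_inner_smul_left, real_inner_smul_right, hon.2 hmn, mul_zero, mul_zero]
  have heig : ∀ n w, inner ℝ (‖J (v n)‖⁻¹ • v n) w =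
      (c n)⁻¹ * inner ℝ (J (‖J (v n)‖⁻¹ • v n)) (J w) := fun n w => by
    rw [map_smul, real_inner_smul_left, real_inner_smul_left, hinner, mul_left_comm,
      inv_mul_cancel_left₀ (hc n).ne']
  -- The eigenvectors of `J* J` are rescaled so that their images under `J` have norm one; they stay
  -- orthogonal in `E`, and the equation `⟪J v, J w⟫ = c n * ⟪v, w⟫` is inverted.
  refine ⟨fun n => (c n)⁻¹, fun n => ‖J (v n)‖⁻¹ • v n, fun m n hmn => inv_anti₀ (hc n) (hanti hmn),
    (tendsto_nhdsWithin_iff.2 ⟨hlim, .of_forall hc⟩).inv_tendsto_nhdsGT_zero, heig,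
    ⟨fun n => ?_, fun m n hmn => ?_⟩, fun n x hx => ?_,
    ⟨fun n => smul_ne_zero (ha' n) (hv0 n), horth, ?_⟩⟩
  · beta_reduce
    rw [map_smul, norm_smul, norm_inv, norm_norm, inv_mul_cancel₀ (ha n)]
  -- Orthogonality of the images follows from that of the vectors through the eigenvalue equation,
  -- as the eigenvalue is nonzero.
  · have h1 := heig m (‖J (v n)‖⁻¹ • v n)
    rw [horth hmn] at h1
    exact (mul_eq_zero.1 h1.symm).resolve_left (inv_ne_zero (hc m).ne')
  · have h1 := hmax n x fun i hi => by
      have h2 := hx i hi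
      rw [real_inner_smul_left] at h2
      exact (mul_eq_zero.1 h2).resolve_left (ha' i)
    rw [hS, real_inner_self_eq_norm_sq] at h1
    rwa [inv_mul_le_iff₀ (hc n)]
  · rw [span_range_smul ha', hspan]

end CompactEmbedding

/-! ### Constant fields, and infinite dimension of `W(Ω)` -/

section Dimension

variable {d : ℕ} {Ω : Set (Pt d)}

theorem HasWeakGradient.isDivFree_of_zero {Φ : L2Mat Ω} (h : HasWeakGradient Φ 0) :
    IsDivFree Φ := by
  refine isDivFree_iff.2 fun j ζ hζ => Finset.sum_eq_zero fun i _ => ?_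
  rw [hasWeakGradient_iff.1 h i j ζ hζ i]
  rw [setIntegral_entry_mul, neg_eq_zero]
  refine (integral_congr_ae (g := fun _ => (0 : ℝ)) ?_).trans (by simp)
  filter_upwards [Lp.coeFn_zero (Ten d) 2 (volume.restrict Ω)] with x hx
  rw [hx, Pi.zero_apply, PiLp.zero_apply, zero_mul]

variable [IsFiniteMeasure (volume.restrict Ω)]

theorem hasWeakGradient_const (A : Mat d) :
    HasWeakGradient (Lp.constL 2 (volume.restrict Ω) ℝ A : L2Mat Ω) (0 : L2Ten Ω) := by
  refine hasWeakGradient_iff.2 fun i j ζ hζ k => ?_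
  have h1 := integral_mul_pderiv (u := fun _ => A (i, j)) contDiff_const hζ k
  have h2 : ∀ x, pderiv k (fun _ : Pt d => A (i, j)) x = 0 := fun x => by simp [pderiv]
  simp_rw [h2] at h1
  simp only [map_zero]
  rw [setIntegral_entry_mul]
  have h3 : ∫ x in Ω, (0 : L2 Ω) x * ζ x = 0 := by
    refine (integral_congr_ae (g := fun _ => (0 : ℝ)) ?_).trans (by simp)
    filter_upwards [Lp.coeFn_zero ℝ 2 (volume.restrict Ω)] with x hx
    rw [hx, Pi.zero_apply, zero_mul]
  rw [h3, neg_zero]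
  refine (integral_congr_ae ?_).trans (h1.trans (by simp))
  filter_upwards [Lp.coeFn_const (p := 2) (μ := volume.restrict Ω) (c := A)] with x hx
  exact congrArg (fun B : Mat d => B (i, j) * pderiv k ζ x) hx

/-- The constant fields, as elements of `W(Ω)`. -/
noncomputable def constField (Ω : Set (Pt d)) [IsFiniteMeasure (volume.restrict Ω)] :
    Mat d →ₗ[ℝ] WSpace Ω where
  toFun A := ⟨WithLp.toLp 2 (Lp.constL 2 (volume.restrict Ω) ℝ A, 0), hasWeakGradient_const A,
    (hasWeakGradient_const A).isDivFree_of_zero⟩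
  map_add' A B := Subtype.ext <| WithLp.ofLp_injective 2 <|
    Prod.ext (map_add _ A B) (add_zero _).symm
  map_smul' c A := Subtype.ext <| WithLp.ofLp_injective 2 <|
    Prod.ext (map_smul _ c A) (smul_zero _).symm

theorem grad_constField (A : Mat d) : WSpace.grad (constField Ω A) = 0 := rfl

theorem injective_constField (hΩ : IsOpen Ω) (hne : Ω.Nonempty) :
    Function.Injective (constField Ω) := by
  rw [← LinearMap.ker_eq_bot, LinearMap.ker_eq_bot']
  intro A hA
  have h1 : Lp.constL 2 (volume.restrict Ω) ℝ A = 0 := congrArg (fieldL Ω) hA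
  have h2 : NeZero (volume.restrict Ω) := ⟨by
    rw [Ne, Measure.restrict_eq_zero]
    exact (hΩ.measure_pos _ hne).ne'⟩
  have h3 : (fun _ => A) =ᵐ[volume.restrict Ω] fun _ => (0 : Mat d) := by
    have h4 := Lp.coeFn_zero (Mat d) 2 (volume.restrict Ω)
    rw [← h1] at h4
    exact (Lp.coeFn_const (p := 2) (μ := volume.restrict Ω) (c := A)).symm.trans h4
  obtain ⟨x, hx⟩ := h3.exists
  exact hx

/-- The gradient vanishes, so constants have Rayleigh quotient exactly `1`. -/
theorem inner_fieldL_constField (A : Mat d) :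
    inner ℝ (fieldL Ω (constField Ω A)) (fieldL Ω (constField Ω A)) = ‖constField Ω A‖ ^ 2 := by
  rw [← real_inner_self_eq_norm_sq (constField Ω A), WSpace.inner_eq (constField Ω A), grad_constField]
  simp

/-- The fields whose only nonzero entry is the `(i₀, i₀)` one, equal to a power of the other
coordinate `x i₁`, are divergence free. This is where `2 ≤ d` enters. A linear relation among them
is a polynomial in `x i₁` vanishing on an open set. -/
theorem not_finiteDimensional_WSpace (hd : 2 ≤ d) (hΩ : IsOpen Ω) (hne : Ω.Nonempty)
    (hb : Bornology.IsBounded Ω) : ¬ FiniteDimensional ℝ (WSpace Ω) := by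
  intro hfin
  let i₀ : Fin d := ⟨0, by omega⟩
  let i₁ : Fin d := ⟨1, by omega⟩
  have h01 : i₀ ≠ i₁ := by simp [i₀, i₁]
  have hc : ∀ n : ℕ, ContDiff ℝ 1 fun x : Pt d => x i₁ ^ n := fun n => by fun_prop
  have hp : ∀ (n : ℕ) (x : Pt d), pderiv i₀ (fun x : Pt d => x i₁ ^ n) x = 0 := by
    intro n x
    have h1 : HasFDerivAt (fun x : Pt d => x i₁) (EuclideanSpace.proj i₁ : Pt d →L[ℝ] ℝ) x :=
      (EuclideanSpace.proj i₁ : Pt d →L[ℝ] ℝ).hasFDerivAt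
    rw [pderiv, (h1.pow n).fderiv]
    simp [h01.symm]
  choose w hw using fun n : ℕ => exists_WSpace_of_contDiff hΩ hb
    (u := fun i j x => if i = i₀ then if j = i₀ then x i₁ ^ n else 0 else 0)
    (fun i j => by
      split_ifs
      exacts [hc n, contDiff_const, contDiff_const])
    (fun j x _ => by
      refine Finset.sum_eq_zero fun i _ => ?_
      by_cases hi : i = i₀
      · by_cases hj : j = i₀
        · simp only [hi, hj, if_true, hp]
        · simp [hj, pderiv]
      · simp [hi, pderiv])
  have hlin : LinearIndependent ℝ w := by
    rw [linearIndependent_iff']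
    intro s g hg n hn
    let p : Polynomial ℝ := ∑ m ∈ s, Polynomial.monomial m (g m)
    have hcont : Continuous fun x : Pt d => p.eval (x i₁) := by fun_prop
    have hae : (fun x : Pt d => p.eval (x i₁)) =ᵐ[volume.restrict Ω] fun _ => 0 := by
      have h1 : ∑ m ∈ s, g m • entry Ω (i₀, i₀) (fieldL Ω (w m)) = 0 := by
        simpa using congrArg (fun w => entry Ω (i₀, i₀) (fieldL Ω w)) hg
      have h2 : ∀ᵐ x ∂(volume.restrict Ω), ∀ m,
          (g m • entry Ω (i₀, i₀) (fieldL Ω (w m)) : L2 Ω) x = g m * x i₁ ^ m := by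
        refine ae_all_iff.2 fun m => ?_
        filter_upwards [hw m i₀ i₀, Lp.coeFn_smul (g m) (entry Ω (i₀, i₀) (fieldL Ω (w m)))]
          with x h3 h4
        rw [h4, Pi.smul_apply, h3]
        simp
      have h5 := Lp.coeFn_fun_finsetSum s fun m => g m • entry Ω (i₀, i₀) (fieldL Ω (w m))
      rw [h1] at h5
      filter_upwards [h2, h5, Lp.coeFn_zero ℝ 2 (volume.restrict Ω)] with x h2 h5 h6
      rw [h6] at h5
      simp_rw [h2] at h5
      simp [p, Polynomial.eval_finsetSum, ← h5]
    have hzero : Set.EqOn (fun x : Pt d => p.eval (x i₁)) (fun _ => 0) Ω :=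
      Measure.eqOn_open_of_ae_eq hae hΩ hcont.continuousOn continuousOn_const
    have hp0 : p = 0 := by
      obtain ⟨x, hx⟩ := hne
      have hline : Continuous fun t : ℝ => x + t • (EuclideanSpace.single i₁ 1 : Pt d) := by fun_prop
      have hnhds : ∀ᶠ t : ℝ in 𝓝 0, x + t • (EuclideanSpace.single i₁ 1 : Pt d) ∈ Ω :=
        hline.continuousAt.eventually_mem (by simpa using hΩ.mem_nhds hx)
      -- Moving a point of `Ω` slightly along the axis `i₁` gives infinitely many roots.
      refine Polynomial.eq_zero_of_infinite_isRoot p (Set.Infinite.mono (s :=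
        (fun t => x i₁ + t) '' {t : ℝ | x + t • (EuclideanSpace.single i₁ 1 : Pt d) ∈ Ω}) ?_ ?_)
      · rintro _ ⟨t, ht, rfl⟩
        simpa using hzero ht
      · exact (infinite_of_mem_nhds 0 hnhds).image (add_right_injective (x i₁)).injOn
    have hcoef : p.coeff n = g n := by
      simp [p, Polynomial.finsetSum_coeff, Polynomial.coeff_monomial, hn]
    rw [← hcoef, hp0, Polynomial.coeff_zero]
  exact Module.Finite.not_linearIndependent_of_infinite w hlin

end Dimension

/-! ### Passage from the abstract problem to fields -/

section Eigenfunctions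

variable {d : ℕ} {Ω : Set (Pt d)}

/-- The embedding of `W(Ω)` into `H(Ω)`. -/
noncomputable def fieldH (Ω : Set (Pt d)) : WSpace Ω →L[ℝ] HSpace Ω :=
  (fieldL Ω).codRestrict (HSpace Ω) fun w => w.2.2

/-- A continuous linear map with dense range sends a dense subspace to a dense subspace; this
carries completeness from `W(Ω)` to `H(Ω)`. -/
theorem topologicalClosure_span_field {v : ℕ → WSpace Ω} (hdense : DenseRange (fieldH Ω))
    (hv : (Submodule.span ℝ (Set.range v)).topologicalClosure = ⊤) :
    (Submodule.span ℝ (Set.range fun n => WSpace.field (v n))).topologicalClosure = ⊤ := by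
  have h1 := hdense.topologicalClosure_map_submodule hv
  rw [Submodule.map_span, ← Set.range_comp] at h1
  exact h1

theorem isEigenfunction_of_inner_eq {lam : ℝ} {v : WSpace Ω} (hv : v ≠ 0)
    (h : ∀ w, inner ℝ v w = lam * inner ℝ (fieldL Ω v) (fieldL Ω w)) : IsEigenfunction lam v :=
  ⟨hv, fun w => by
    have h1 := h w
    rw [WSpace.inner_eq v w, add_comm] at h1
    exact h1⟩

/-- There is a nonzero constant field orthogonal to fewer than `d ^ 2` given fields. -/
theorem exists_constField_orthogonal [IsFiniteMeasure (volume.restrict Ω)] (v : ℕ → WSpace Ω)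
    {n : ℕ} (hn : n < d ^ 2) :
    ∃ A : Mat d, A ≠ 0 ∧ ∀ i < n, inner ℝ (v i) (constField Ω A) = 0 := by
  let L : Mat d →ₗ[ℝ] (Fin n → ℝ) :=
    LinearMap.pi fun i => (innerSL ℝ (v i) : WSpace Ω →ₗ[ℝ] ℝ) ∘ₗ constField Ω
  have hL : LinearMap.ker L ≠ ⊥ := by
    refine LinearMap.ker_ne_bot_of_finrank_lt ?_
    simpa [sq] using hn
  obtain ⟨A, hA, hA0⟩ := (Submodule.ne_bot_iff _).1 hL
  exact ⟨A, hA0, fun i hi => congrFun (LinearMap.mem_ker.1 hA) ⟨i, hi⟩⟩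

end Eigenfunctions

end DivFree

open DivFree in
theorem theorem4 (d : ℕ) (hd : 2 ≤ d) (Ω : Set (DivFree.Pt d))
    (hΩ : DivFree.IsBoundedLipschitzDomain Ω) :
    ∃ (lam : ℕ → ℝ) (Φ : ℕ → DivFree.WSpace Ω),
      (∀ j, j < d ^ 2 → lam j = 1) ∧ Monotone lam ∧ Tendsto lam atTop atTop ∧
      (∀ j, DivFree.IsEigenfunction (lam j) (Φ j)) ∧
      DivFree.IsOrthonormalBasis (fun j => DivFree.WSpace.field (Φ j)) ∧
      DivFree.IsOrthogonalBasis Φ := by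
  have hfin : IsFiniteMeasure (volume.restrict Ω) :=
    ⟨by simpa using hΩ.isBounded.measure_lt_top⟩
  obtain ⟨ι, _, ⟨P⟩⟩ := hΩ.exists_inwardPartition
  have hne := hΩ.isConnected.nonempty
  obtain ⟨lam, v, hmono, hlim, heig, hon, hmax, hbasis⟩ := exists_eigenvectors_of_isCompactOperator
    (P.isCompactOperator_fieldL hΩ.isOpen hΩ.isBounded) (injective_fieldL hΩ.isOpen)
    (not_finiteDimensional_WSpace hd hΩ.isOpen hne hΩ.isBounded)
  have hdense : DenseRange (fieldH Ω) := by
    refine Metric.dense_iff.2 fun Φ ε hε => ?_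
    obtain ⟨w, hw⟩ := P.exists_norm_fieldL_sub_lt hΩ.isOpen hΩ.isBounded Φ.2 hε
    refine ⟨fieldH Ω w, ?_, w, rfl⟩
    rw [Metric.mem_ball, Subtype.dist_eq, dist_eq_norm]
    exact hw
  refine ⟨lam, v, fun n hn => le_antisymm ?_ ?_, hmono, hlim,
    fun n => isEigenfunction_of_inner_eq (hbasis.1 n) (heig n),
    ⟨⟨hon.1, hon.2⟩, topologicalClosure_span_field hdense hbasis.2.2⟩, hbasis⟩
  -- Upper bound: counting from `0`, there are `n < d ^ 2` eigenfunctions before the `n`-th, so a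
  -- nonzero constant field is orthogonal to them, and its quotient `1` bounds `lam n`.
  · obtain ⟨A, hA, hA'⟩ := exists_constField_orthogonal v hn
    have h1 := hmax n _ hA'
    rw [← real_inner_self_eq_norm_sq (fieldL Ω _), inner_fieldL_constField] at h1
    have h2 : 0 < ‖constField Ω A‖ :=
      norm_pos_iff.2 ((map_ne_zero_iff _ (injective_constField hΩ.isOpen hne)).2 hA)
    exact le_of_mul_le_mul_right (by rwa [one_mul]) (pow_pos h2 2)
  -- Lower bound: the equation tested with `v n` gives `lam n = ‖v n‖ ^ 2`, and the `L²` norm, here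
  -- `1`, is at most the norm in `W(Ω)`.
  · have h1 := heig n (v n)
    rw [real_inner_self_eq_norm_sq, real_inner_self_eq_norm_sq, hon.1 n, one_pow, mul_one] at h1
    rw [← h1]
    refine one_le_pow₀ ?_
    rw [← hon.1 n]
    exact WSpace.norm_field_le _
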